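/- Let $n\ge 3$ and $m\ge 1$ be integers, let $\Gamma$ be a closed subgroup of $O(n)$ and let $\phi:\Gamma\to\mathbb Z_2=\{1,-1\}$ be a continuous homomorphism. Let $\Theta\subset\mathbb R^n$ be a bounded $\Gamma$-invariant domain with $\overline\Theta\subset\mathbb R^{n-1}\times(0,\infty)$, and let $\Theta^\Gamma:=\{x\in\Theta:\gamma x=x\ \forall\gamma\in\Gamma\}$. Assume that $\Theta^\Gamma$ and $\Theta\smallsetminus\Theta^\Gamma$ are nonempty, that every $\Gamma$-orbit $\Gamma x=\{\gamma x:\gamma\in\Gamma\}$ with $x\in\Theta\smallsetminus\Theta^\Gamma$ has positive dimension, and that there is $x_0\in\Theta$ with $\{\gamma\in\Gamma:\gamma x_0=x_0\}\subset\ker\phi$. For $\delta>0$ put $\Theta_\delta:=\{x\in\Theta:\operatorname{dist}(x,\Theta^\Gamma)>\delta\}$. Let $2^*_n:=\frac{2n}{n-2}$ and let $D^{1,2}(\mathbb R^n)$ be the space of all $u\in L^{2^*_n}(\mathbb R^n)$ whose weak gradient lies in $L^2(\mathbb R^n,\mathbb R^n)$, with the norm $\|u\|:=\left(\int|\nabla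 u|^2\right)^{1/2}$. For an open set $U\subset\mathbb R^n$ let $D^{1,2}_0(U)$ be the closure of $\mathcal C^\infty_c(U)$ in $D^{1,2}(\mathbb R^n)$, and let $D^{1,2}_0(U)^\phi$ be the set of those $u\in D_0^{1,2}(U)$ that satisfy $u(\gamma x)=\phi(\gamma)u(x)$ for all $\gamma\in\Gamma$ and almost every $x\in\mathbb R^n$. Set $$\lambda_1^\phi:=\inf_{u\in D_0^{1,2}(\Theta)^\phi,\ u\ne0}\frac{\int_\Theta x_n^m|\nabla u|^2\,dx}{\int_\Theta x_n^m u^2\,dx},$$ and let $\lambda\in(-\lambda_1^\phi,\infty)$. For $U=\Theta$ or $U=\Theta_\delta$ let $$J_U(u):=\frac12\int_U\left(x_n^m|\nabla u|^2+\lambda x_n^m u^2\right)dx-\frac1{2^*_n}\int_U x_n^m|u|^{2^*_n}\,dx,$$ $$\mathcal N_U^\phi:=\Big\{u\in D_0^{1,2}(U)^\phi:\ u\neq0,\ \int_U\left(x_n^m|\nabla u|^2+\lambda x_n^m u^2\right)dx=\int_U x_n^m|u|^{2^*_n}\,dx\Big\}.$$ Put $\ell^\phi_{\delta,2^*_n}:=\inf\{J_{\Theta_\delta}(u):u\in\mathcal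 N^\phi_{\Theta_\delta}\}$ for $\delta>0$ and $\ell^\phi_*:=\inf\{J_\Theta(u):u\in\mathcal N^\phi_\Theta\}$. Then $$\ell^\phi_{\delta,2^*_n}\to\ell^\phi_*\qquad\text{as }\delta\to0^+ .$$ -/

import Mathlib

open MeasureTheory Filter Topology Set
open scoped ContDiff

noncomputable section

namespace HoledDomain

/-- `ℝⁿ` with its Euclidean structure. -/
abbrev E (n : ℕ) : Type := EuclideanSpace ℝ (Fin n)

/-- The orthogonal group `O(n)`, with the topology inherited from the matrices. -/
abbrev O (n : ℕ) : Type := Matrix.orthogonalGroup (Fin n) ℝ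

/-- The linear action of `O(n)` on `ℝⁿ`: `γ x` is the matrix-vector product. -/
def act {n : ℕ} (γ : O n) (x : E n) : E n :=
  WithLp.toLp 2 (Matrix.mulVec (γ : Matrix (Fin n) (Fin n) ℝ) (WithLp.ofLp x))

/-- The orbit `Γ x`. -/
def orbit {n : ℕ} (Γ : Subgroup (O n)) (x : E n) : Set (E n) :=
  {y | ∃ γ ∈ Γ, y = act γ x}

/-- `Θ` is `Γ`-invariant. -/
def IsInvariant {n : ℕ} (Γ : Subgroup (O n)) (Θ : Set (E n)) : Prop :=
  ∀ γ ∈ Γ, ∀ x ∈ Θ, act γ x ∈ Θ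

/-- `Θ^Γ`, the set of the fixed points of `Γ` that lie in `Θ`. -/
def fixedPts {n : ℕ} (Γ : Subgroup (O n)) (Θ : Set (E n)) : Set (E n) :=
  {x ∈ Θ | ∀ γ ∈ Γ, act γ x = x}

/-- `Θ_δ = {x ∈ Θ : dist (x, Θ^Γ) > δ}`, for `δ > 0` (and `Θ^Γ` nonempty). -/
def holed {n : ℕ} (Γ : Subgroup (O n)) (Θ : Set (E n)) (δ : ℝ) : Set (E n) :=
  {x ∈ Θ | δ < Metric.infDist x (fixedPts Γ Θ)}

/-- The last coordinate `x_n` of `x ∈ ℝⁿ`. -/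
def lastCoord {n : ℕ} (hn : 3 ≤ n) (x : E n) : ℝ := x ⟨n - 1, by omega⟩

/-- The critical Sobolev exponent `2*_n = 2n / (n - 2)` (for `n ≥ 3`). -/
def critExp (n : ℕ) : ℝ := 2 * (n : ℝ) / ((n : ℝ) - 2)

/-- `ψ ∈ C_c^∞(U)`. -/
def IsTestFun {n : ℕ} (U : Set (E n)) (ψ : E n → ℝ) : Prop :=
  ContDiff ℝ ∞ ψ ∧ HasCompactSupport ψ ∧ tsupport ψ ⊆ U

/-- `G` is a weak gradient of `u` on `ℝⁿ`. -/
def IsWeakGrad {n : ℕ} (u : E n → ℝ) (G : E n → E n) : Prop :=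
  LocallyIntegrable u ∧ LocallyIntegrable G ∧
    ∀ ψ : E n → ℝ, IsTestFun univ ψ →
      ∫ x, u x • gradient ψ x = - ∫ x, ψ x • G x

open Classical in
/-- The weak gradient `∇u` (unique up to null sets) of a function that has one. -/
def weakGrad {n : ℕ} (u : E n → ℝ) : E n → E n :=
  if h : ∃ G, IsWeakGrad u G then h.choose else 0

/-- `u ∈ D^{1,2}(ℝⁿ)`: `u ∈ L^{2*}` has a weak gradient, and it lies in `L²`.
Functions stand for their classes modulo equality almost everywhere. -/
def MemD {n : ℕ} (u : E n → ℝ) : Prop :=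
  MemLp u (ENNReal.ofReal (critExp n)) volume ∧ (∃ G, IsWeakGrad u G) ∧
    MemLp (weakGrad u) 2 volume

/-- `u ∈ D_0^{1,2}(U)`: the closure of `C_c^∞(U)` in `D^{1,2}(ℝⁿ)` for the norm `‖∇u‖_{L²}`. -/
def MemD0 {n : ℕ} (U : Set (E n)) (u : E n → ℝ) : Prop :=
  MemD u ∧ ∀ ε : ENNReal, 0 < ε → ∃ ψ : E n → ℝ, IsTestFun U ψ ∧
    eLpNorm (fun x => weakGrad u x - gradient ψ x) 2 volume < ε

/-- `u` is `φ`-equivariant, `u (γ x) = φ(γ) u(x)`, as an element of a space of classes of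
functions modulo equality almost everywhere; `ℤ₂ = {1, -1}` is the group of units of `ℤ`. -/
def IsEquivariant {n : ℕ} (Γ : Subgroup (O n)) (φ : Γ →* ℤˣ) (u : E n → ℝ) : Prop :=
  ∀ γ : Γ, ∀ᵐ x ∂(volume : Measure (E n)), u (act (γ : O n) x) = (((φ γ : ℤˣ) : ℤ) : ℝ) * u x

/-- The space `D_0^{1,2}(U)^φ` of the `φ`-equivariant elements of `D_0^{1,2}(U)`. -/
def D0equiv {n : ℕ} (Γ : Subgroup (O n)) (φ : Γ →* ℤˣ) (U : Set (E n)) : Set (E n → ℝ) :=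
  {u | MemD0 U u ∧ IsEquivariant Γ φ u}

/-- `λ_1^φ`: the infimum of `∫_Θ x_n^m |∇u|² / ∫_Θ x_n^m u²` over the nonzero elements `u`
of `D_0^{1,2}(Θ)^φ`. -/
def lambda1 {n : ℕ} (hn : 3 ≤ n) (m : ℕ) (Γ : Subgroup (O n)) (φ : Γ →* ℤˣ)
    (Θ : Set (E n)) : ℝ :=
  sInf {r | ∃ u ∈ D0equiv Γ φ Θ, ¬ (u =ᵐ[volume] 0) ∧
    r = (∫ x in Θ, lastCoord hn x ^ m * ‖weakGrad u x‖ ^ 2) /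
      (∫ x in Θ, lastCoord hn x ^ m * u x ^ 2)}

/-- `∫_U (x_n^m |∇u|² + λ x_n^m u²) dx`. -/
def quadForm {n : ℕ} (hn : 3 ≤ n) (m : ℕ) (lam : ℝ) (U : Set (E n)) (u : E n → ℝ) : ℝ :=
  ∫ x in U, (lastCoord hn x ^ m * ‖weakGrad u x‖ ^ 2 + lam * lastCoord hn x ^ m * u x ^ 2)

/-- `∫_U x_n^m |u|^{2*} dx`. -/
def critTerm {n : ℕ} (hn : 3 ≤ n) (m : ℕ) (U : Set (E n)) (u : E n → ℝ) : ℝ :=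
  ∫ x in U, lastCoord hn x ^ m * |u x| ^ critExp n

/-- The energy functional of
`-div (x_n^m ∇u) + λ x_n^m u = x_n^m |u|^{2* - 2} u` in `U`, `u = 0` on `∂U`. -/
def energy {n : ℕ} (hn : 3 ≤ n) (m : ℕ) (lam : ℝ) (U : Set (E n)) (u : E n → ℝ) : ℝ :=
  1 / 2 * quadForm hn m lam U u - 1 / critExp n * critTerm hn m U u

/-- The Nehari manifold of `energy` in `D_0^{1,2}(U)^φ`. -/
def nehari {n : ℕ} (hn : 3 ≤ n) (m : ℕ) (lam : ℝ) (Γ : Subgroup (O n)) (φ : Γ →* ℤˣ)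
    (U : Set (E n)) : Set (E n → ℝ) :=
  {u | u ∈ D0equiv Γ φ U ∧ quadForm hn m lam U u = critTerm hn m U u ∧ ¬ (u =ᵐ[volume] 0)}

/-- The critical least energy level: the infimum of the energy on the Nehari manifold. -/
def leastEnergy {n : ℕ} (hn : 3 ≤ n) (m : ℕ) (lam : ℝ) (Γ : Subgroup (O n)) (φ : Γ →* ℤˣ)
    (U : Set (E n)) : ℝ :=
  sInf (energy hn m lam U '' nehari hn m lam Γ φ U)

end HoledDomain

end

noncomputable section

namespace HoledDomain

variable {n : ℕ}

/-! ### Gradients of test functions -/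

/-! One inequality is extension by zero: the Nehari manifold of a holed domain lies in that of `Θ`,
with the same energy (`nehari_subset`), so removing a neighbourhood of the fixed points can only
raise the level, as long as the smaller manifold is nonempty.

For the converse, a given `u` in the Nehari manifold of `Θ` is approximated by equivariant functions
on the holed domains. An orthogonal action whose fixed space has codimension at most one has finite
orbits (`finite_orbit`), so an orbit of positive dimension forces codimension at least two. A
subspace `N` of codimension two has zero capacity for the Dirichlet norm: gradients of test
functions in `Θ` are limits of gradients of test functions in `Θ \ N`
(`IsTestFun.toLp_gradient_mem_gradSpace_diff`), and a compact support in `Θ \ N` lies in the holed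
domain once `δ` is small.

These approximations need not be equivariant. Instead of averaging over `Γ`, the gradient of `u` is
projected orthogonally onto the gradients available on the holed domain; the nearest point is unique
and the action is isometric, so the projection inherits the symmetry (`exists_mem_D0equiv_le`). By
the Sobolev inequality both terms of the energy converge along the projections, and a scaling factor
tending to `1` puts them on the Nehari manifold (`eventually_exists_nehari_holed_lt`). -/

theorem inner_gradient_left (f : E n → ℝ) (x v : E n) :
    inner ℝ (gradient f x) v = fderiv ℝ f x v := by
  simp [gradient]

theorem norm_gradient (f : E n → ℝ) (x : E n) : ‖gradient f x‖ = ‖fderiv ℝ f x‖ := by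
  simp [gradient]

namespace IsTestFun

variable {U W : Set (E n)} {ψ θ : E n → ℝ}

theorem differentiable (h : IsTestFun U ψ) : Differentiable ℝ ψ := h.1.differentiable (by simp)

theorem continuous (h : IsTestFun U ψ) : Continuous ψ := h.1.continuous

theorem contDiff_one (h : IsTestFun U ψ) : ContDiff ℝ 1 ψ := h.1.of_le (by simp)

theorem mono (h : IsTestFun U ψ) (hUW : U ⊆ W) : IsTestFun W ψ := ⟨h.1, h.2.1, h.2.2.trans hUW⟩

theorem to_univ (h : IsTestFun U ψ) : IsTestFun univ ψ := h.mono (subset_univ _)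

theorem continuous_gradient (h : IsTestFun U ψ) : Continuous (gradient ψ) :=
  (InnerProductSpace.toDual ℝ (E n)).symm.continuous.comp (h.1.continuous_fderiv (by simp))

theorem hasCompactSupport_gradient (h : IsTestFun U ψ) : HasCompactSupport (gradient ψ) :=
  (h.2.1.fderiv ℝ).comp_left (g := (InnerProductSpace.toDual ℝ (E n)).symm) (by simp)

theorem gradient_eq_zero (h : IsTestFun U ψ) {x : E n} (hx : x ∉ U) : gradient ψ x = 0 := by
  have : x ∉ tsupport (fderiv ℝ ψ) := fun hx' => hx (h.2.2 (tsupport_fderiv_subset ℝ hx'))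
  simp [gradient, image_eq_zero_of_notMem_tsupport this]

theorem eq_zero (h : IsTestFun U ψ) {x : E n} (hx : x ∉ U) : ψ x = 0 :=
  image_eq_zero_of_notMem_tsupport fun hx' => hx (h.2.2 hx')

theorem memLp (h : IsTestFun U ψ) (p : ENNReal) : MemLp ψ p volume :=
  h.continuous.memLp_of_hasCompactSupport h.2.1

theorem memLp_gradient (h : IsTestFun U ψ) (p : ENNReal) : MemLp (gradient ψ) p volume :=
  h.continuous_gradient.memLp_of_hasCompactSupport h.hasCompactSupport_gradient

theorem zero : IsTestFun U (0 : E n → ℝ) :=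
  ⟨contDiff_const, HasCompactSupport.zero, by simp⟩

theorem add (h : IsTestFun U ψ) (k : IsTestFun U θ) : IsTestFun U (ψ + θ) :=
  ⟨h.1.add k.1, h.2.1.add k.2.1, (tsupport_add ψ θ).trans (union_subset h.2.2 k.2.2)⟩

theorem const_smul (h : IsTestFun U ψ) (c : ℝ) : IsTestFun U (c • ψ) :=
  ⟨h.1.const_smul c, h.2.1.smul_left (f := fun _ => c),
    (tsupport_smul_subset_right (fun _ => c) ψ).trans h.2.2⟩

theorem gradient_add (h : IsTestFun U ψ) (k : IsTestFun U θ) :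
    gradient (ψ + θ) = gradient ψ + gradient θ := by
  ext1 x
  simp [gradient, fderiv_add (h.differentiable x) (k.differentiable x)]

theorem gradient_const_smul (h : IsTestFun U ψ) (c : ℝ) :
    gradient (c • ψ) = c • gradient ψ := by
  ext1 x
  simp [gradient, fderiv_const_smul (h.differentiable x) c]

theorem sub (h : IsTestFun U ψ) (k : IsTestFun U θ) : IsTestFun U (ψ - θ) := by
  simpa [sub_eq_add_neg] using h.add (k.const_smul (-1))

theorem gradient_sub (h : IsTestFun U ψ) (k : IsTestFun U θ) :
    gradient (ψ - θ) = gradient ψ - gradient θ := by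
  ext1 x
  simp [gradient, fderiv_sub (h.differentiable x) (k.differentiable x)]

theorem comp_isometry (h : IsTestFun U ψ) (A : E n ≃ₗᵢ[ℝ] E n) :
    IsTestFun (A ⁻¹' U) (ψ ∘ A) := by
  refine ⟨h.1.comp A.contDiff, h.2.1.comp_homeomorph A.toHomeomorph, ?_⟩
  intro x hx
  have : tsupport (ψ ∘ A) = A ⁻¹' tsupport ψ :=
    tsupport_comp_eq_preimage ψ A.toHomeomorph
  exact h.2.2 (by rwa [this] at hx)

theorem isWeakGrad (h : IsTestFun U ψ) : IsWeakGrad ψ (gradient ψ) := by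
  refine ⟨h.continuous.locallyIntegrable, h.continuous_gradient.locallyIntegrable, fun θ k => ?_⟩
  have i1 : Integrable (fun x => ψ x • gradient θ x) :=
    (h.continuous.smul k.continuous_gradient).integrable_of_hasCompactSupport h.2.1.smul_right
  have i2 : Integrable (fun x => θ x • gradient ψ x) :=
    (k.continuous.smul h.continuous_gradient).integrable_of_hasCompactSupport k.2.1.smul_right
  refine ext_inner_left ℝ fun v => ?_
  rw [inner_neg_right, ← integral_inner i1, ← integral_inner i2]
  have e1 : ∀ x, inner ℝ v (ψ x • gradient θ x) = ψ x * fderiv ℝ θ x v := fun x => by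
    rw [inner_smul_right, real_inner_comm, inner_gradient_left]
  have e2 : ∀ x, inner ℝ v (θ x • gradient ψ x) = fderiv ℝ ψ x v * θ x := fun x => by
    rw [inner_smul_right, real_inner_comm, inner_gradient_left, mul_comm]
  have j1 := i1.const_inner (𝕜 := ℝ) v
  have j2 := i2.const_inner (𝕜 := ℝ) v
  simp only [e1, e2] at j1 j2 ⊢
  exact integral_mul_fderiv_eq_neg_fderiv_mul_of_integrable j2 j1
    ((h.continuous.mul k.continuous).integrable_of_hasCompactSupport h.2.1.mul_right)
    (fun x _ => h.differentiable x) (fun x _ => k.differentiable x)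

end IsTestFun

theorem gradient_comp_isometry {ψ : E n → ℝ} (h : Differentiable ℝ ψ) (A : E n ≃ₗᵢ[ℝ] E n)
    (x : E n) : gradient (ψ ∘ A) x = A.symm (gradient ψ (A x)) := by
  refine ext_inner_right ℝ fun v => ?_
  rw [inner_gradient_left, fderiv_comp x (h _) A.differentiable.differentiableAt,
    ← A.inner_map_map, A.apply_symm_apply, inner_gradient_left]
  simp [A.toContinuousLinearEquiv.fderiv, ← LinearIsometryEquiv.coe_toContinuousLinearEquiv]

theorem gradient_mul {f g : E n → ℝ} {x : E n} (hf : DifferentiableAt ℝ f x)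
    (hg : DifferentiableAt ℝ g x) :
    gradient (fun y => f y * g y) x = f x • gradient g x + g x • gradient f x := by
  simp [gradient, fderiv_fun_mul hf hg]

/-! ### Weak gradients -/

namespace IsWeakGrad

variable {u v : E n → ℝ} {G H : E n → E n}

theorem integrable_smul_gradient (h : LocallyIntegrable u) {ψ : E n → ℝ} (k : IsTestFun univ ψ) :
    Integrable (fun x => u x • gradient ψ x) :=
  h.integrable_smul_right_of_hasCompactSupport k.continuous_gradient k.hasCompactSupport_gradient

theorem integrable_smul (h : LocallyIntegrable G) {ψ : E n → ℝ} (k : IsTestFun univ ψ) :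
    Integrable (fun x => ψ x • G x) :=
  h.integrable_smul_left_of_hasCompactSupport k.continuous k.2.1

theorem ae_eq (h : IsWeakGrad u G) (k : IsWeakGrad u H) : G =ᵐ[volume] H := by
  have := ae_eq_zero_of_integral_contDiff_smul_eq_zero (h.2.1.sub k.2.1) fun ψ hψ hc => by
    have t : IsTestFun univ ψ := ⟨hψ, hc, subset_univ _⟩
    have e1 := h.2.2 ψ t
    have e2 := k.2.2 ψ t
    simp only [Pi.sub_apply, smul_sub]
    rw [integral_sub (integrable_smul h.2.1 t) (integrable_smul k.2.1 t), sub_eq_zero]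
    exact neg_injective (e1.symm.trans e2)
  filter_upwards [this] with x hx
  exact sub_eq_zero.1 hx

theorem congr (h : IsWeakGrad u G) (huv : u =ᵐ[volume] v) (hGH : G =ᵐ[volume] H) :
    IsWeakGrad v H := by
  refine ⟨h.1.congr huv, h.2.1.congr hGH, fun ψ t => ?_⟩
  have e1 : ∫ x, u x • gradient ψ x = ∫ x, v x • gradient ψ x :=
    integral_congr_ae (huv.mono fun x hx => by simp only [hx])
  have e2 : ∫ x, ψ x • G x = ∫ x, ψ x • H x :=
    integral_congr_ae (hGH.mono fun x hx => by simp only [hx])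
  rw [← e1, ← e2, h.2.2 ψ t]

theorem weakGrad_ae_eq (h : IsWeakGrad u G) : weakGrad u =ᵐ[volume] G := by
  have ex : ∃ G, IsWeakGrad u G := ⟨G, h⟩
  have : IsWeakGrad u (weakGrad u) := by
    rw [weakGrad, dif_pos ex]
    exact ex.choose_spec
  exact this.ae_eq h

theorem sub (h : IsWeakGrad u G) (k : IsWeakGrad v H) : IsWeakGrad (u - v) (G - H) := by
  refine ⟨h.1.sub k.1, h.2.1.sub k.2.1, fun ψ t => ?_⟩
  simp only [Pi.sub_apply, smul_sub, sub_smul]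
  rw [integral_sub (integrable_smul h.2.1 t) (integrable_smul k.2.1 t),
    integral_sub (integrable_smul_gradient h.1 t) (integrable_smul_gradient k.1 t),
    h.2.2 ψ t, k.2.2 ψ t]
  abel

theorem const_smul (h : IsWeakGrad u G) (c : ℝ) : IsWeakGrad (c • u) (c • G) := by
  refine ⟨h.1.smul c, h.2.1.smul c, fun ψ t => ?_⟩
  simp only [Pi.smul_apply, smul_assoc, smul_comm _ c]
  rw [integral_smul, integral_smul, h.2.2 ψ t, smul_neg]

theorem comp_isometry (h : IsWeakGrad u G) (A : E n ≃ₗᵢ[ℝ] E n) :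
    IsWeakGrad (u ∘ A) (fun x => A.symm (G (A x))) := by
  have loc : ∀ {F : Type} [NormedAddCommGroup F] {f : E n → F}, LocallyIntegrable f →
      LocallyIntegrable (f ∘ A) := fun {F} _ f hf => by
    have := (MeasureTheory.locallyIntegrable_map_homeomorph (μ := (volume : Measure (E n)))
      A.toHomeomorph (f := f)).1
    refine this ?_
    have e : Measure.map A.toHomeomorph (volume : Measure (E n)) = volume :=
      A.measurePreserving.map_eq
    rwa [e]
  refine ⟨loc h.1, ?_, fun ψ t => ?_⟩
  · have := loc h.2.1
    intro x
    obtain ⟨s, hs, hi⟩ := this x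
    exact ⟨s, hs, A.symm.toContinuousLinearEquiv.toContinuousLinearMap.integrable_comp hi⟩
  · have t' : IsTestFun univ (ψ ∘ A.symm) := t.comp_isometry A.symm
    have e := h.2.2 _ t'
    have emb := A.toHomeomorph.measurableEmbedding
    rw [← A.measurePreserving.integral_comp emb (fun x => u x • gradient (ψ ∘ A.symm) x),
      ← A.measurePreserving.integral_comp emb (fun x => (ψ ∘ A.symm) x • G x)] at e
    simp only [gradient_comp_isometry t.differentiable, Function.comp_apply,
      A.symm_apply_apply, LinearIsometryEquiv.symm_symm] at e ⊢
    simp only [← map_smul] at e ⊢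
    have e3 := A.toContinuousLinearEquiv.integral_comp_comm (μ := volume)
      (fun x => u (A x) • gradient ψ x)
    have e4 := A.symm.toContinuousLinearEquiv.integral_comp_comm (μ := volume)
      (fun x => ψ x • G (A x))
    simp only [LinearIsometryEquiv.coe_toContinuousLinearEquiv] at e3 e4
    rw [e4]
    rw [e3] at e
    rw [← map_neg, ← e, A.symm_apply_apply]

end IsWeakGrad

/-! ### Limits in Lebesgue spaces -/

theorem enorm_integral_smul_le {α F : Type*} [MeasurableSpace α] {μ : Measure α}
    [NormedAddCommGroup F] [NormedSpace ℝ F] {p q : ENNReal} [p.HolderConjugate q]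
    {θ : α → ℝ} {f : α → F} (hθ : AEStronglyMeasurable θ μ) (hf : AEStronglyMeasurable f μ) :
    ‖∫ x, θ x • f x ∂μ‖ₑ ≤ eLpNorm θ p μ * eLpNorm f q μ := by
  refine (enorm_integral_le_lintegral_enorm _).trans ?_
  rw [← eLpNorm_one_eq_lintegral_enorm]
  exact eLpNorm_smul_le_mul_eLpNorm hf hθ

theorem tendsto_integral_smul_of_eLpNorm {α F ι : Type*} [MeasurableSpace α] {μ : Measure α}
    [NormedAddCommGroup F] [NormedSpace ℝ F] {p q : ENNReal} [p.HolderConjugate q]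
    {l : Filter ι} {θ : α → ℝ} {f : ι → α → F} {g : α → F} (hθ : MemLp θ p μ)
    (hf : ∀ i, MemLp (f i) q μ) (hg : MemLp g q μ)
    (hl : Tendsto (fun i => eLpNorm (f i - g) q μ) l (𝓝 0)) :
    Tendsto (fun i => ∫ x, θ x • f i x ∂μ) l (𝓝 (∫ x, θ x • g x ∂μ)) := by
  refine tendsto_integral_of_L1' _ (hθ.1.smul hg.1)
    (Eventually.of_forall fun i => memLp_one_iff_integrable.1 ((hf i).smul hθ)) ?_
  have hl' := ENNReal.Tendsto.const_mul hl (Or.inr hθ.2.ne)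
  rw [mul_zero] at hl'
  refine tendsto_of_tendsto_of_tendsto_of_le_of_le tendsto_const_nhds hl' (fun _ => zero_le)
    fun i => ?_
  refine le_trans (le_of_eq ?_)
    (eLpNorm_smul_le_mul_eLpNorm (p := p) (q := q) (r := 1) ((hf i).sub hg).1 hθ.1)
  congr 1
  ext1 x
  simp [smul_sub]

theorem tendsto_integral_smul_of_eLpNorm' {α F ι : Type*} [MeasurableSpace α] {μ : Measure α}
    [NormedAddCommGroup F] [NormedSpace ℝ F] {p q : ENNReal} [p.HolderConjugate q]
    {l : Filter ι} {θ : α → F} {f : ι → α → ℝ} {g : α → ℝ} (hθ : MemLp θ q μ)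
    (hf : ∀ i, MemLp (f i) p μ) (hg : MemLp g p μ)
    (hl : Tendsto (fun i => eLpNorm (f i - g) p μ) l (𝓝 0)) :
    Tendsto (fun i => ∫ x, f i x • θ x ∂μ) l (𝓝 (∫ x, g x • θ x ∂μ)) := by
  refine tendsto_integral_of_L1' _ (hg.1.smul hθ.1)
    (Eventually.of_forall fun i => memLp_one_iff_integrable.1 (hθ.smul (hf i))) ?_
  have hl' := ENNReal.Tendsto.mul_const hl (Or.inr hθ.2.ne)
  rw [zero_mul] at hl'
  refine tendsto_of_tendsto_of_tendsto_of_le_of_le tendsto_const_nhds hl' (fun _ => zero_le)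
    fun i => ?_
  refine le_trans (le_of_eq ?_)
    (eLpNorm_smul_le_mul_eLpNorm (p := p) (q := q) (r := 1) hθ.1 ((hf i).sub hg).1)
  congr 1
  ext1 x
  simp [sub_smul]

/-- For a fixed test function both sides of the integration by parts formula are continuous by
Hölder. The two exponents are independent because functions converge in `L^{2*}` and gradients in
`L²`. -/
theorem IsWeakGrad.of_tendsto {ι : Type*} {l : Filter ι} [l.NeBot] {p q : ENNReal}
    (hp : 1 ≤ p) (hq : 1 ≤ q) {u : E n → ℝ} {G : E n → E n} {f : ι → E n → ℝ}
    {g : ι → E n → E n} (h : ∀ i, IsWeakGrad (f i) (g i)) (hf : ∀ i, MemLp (f i) p volume)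
    (hg : ∀ i, MemLp (g i) q volume) (hu : MemLp u p volume) (hG : MemLp G q volume)
    (hfu : Tendsto (fun i => eLpNorm (f i - u) p volume) l (𝓝 0))
    (hgG : Tendsto (fun i => eLpNorm (g i - G) q volume) l (𝓝 0)) : IsWeakGrad u G := by
  refine ⟨hu.locallyIntegrable hp, hG.locallyIntegrable hq, fun ψ t => ?_⟩
  have := ENNReal.HolderConjugate.conjExponent hp
  have := (ENNReal.HolderConjugate.conjExponent hq).symm
  have l1 := tendsto_integral_smul_of_eLpNorm' (q := p.conjExponent) (t.memLp_gradient _) hf hu hfu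
  have l2 := tendsto_integral_smul_of_eLpNorm (p := q.conjExponent) (t.memLp _) hg hG hgG
  exact tendsto_nhds_unique l1 (l2.neg.congr fun i => ((h i).2.2 ψ t).symm)

/-! ### Functions with vanishing weak gradient -/

theorem IsTestFun.comp_sub_left {g : E n → ℝ} (t : IsTestFun univ g) (x : E n) :
    IsTestFun univ (fun y => g (x - y)) :=
  ⟨t.1.comp (contDiff_const.sub contDiff_id), t.2.1.comp_homeomorph (Homeomorph.subLeft x),
    subset_univ _⟩

theorem IsTestFun.gradient_comp_sub_left {g : E n → ℝ} (t : IsTestFun univ g) (x y : E n) :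
    gradient (fun y => g (x - y)) y = -gradient g (x - y) := by
  refine ext_inner_right ℝ fun v => ?_
  have h1 : HasFDerivAt (fun y => x - y) (-ContinuousLinearMap.id ℝ (E n)) y := by
    simpa using (hasFDerivAt_id (𝕜 := ℝ) y).const_sub x
  have h2 := (t.differentiable (x - y)).hasFDerivAt.comp y h1
  rw [inner_neg_left, inner_gradient_left, inner_gradient_left]
  have h3 : fderiv ℝ (fun y => g (x - y)) y = _ := h2.fderiv
  rw [h3]
  simp

/-- The integral of a function with zero weak gradient against the reflected translates of a
test function does not depend on the translation. -/
theorem IsWeakGrad.integral_mul_comp_sub_const {w : E n → ℝ} (h : IsWeakGrad w 0)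
    {g : E n → ℝ} (t : IsTestFun univ g) (x y : E n) :
    ∫ z, w z * g (x - z) = ∫ z, w z * g (y - z) := by
  -- As a function of the translation the integral is the convolution of `w` and `g`; its derivative
  -- is the convolution of `w` with the derivative of `g`, which is zero by the hypothesis on `w`.
  have key := t.2.1.hasFDerivAt_convolution_right (ContinuousLinearMap.mul ℝ ℝ) h.1 t.contDiff_one
  have zero : ∀ x₀, convolution w (fderiv ℝ g)
      ((ContinuousLinearMap.mul ℝ ℝ).precompR (E n)) volume x₀ = 0 := fun x₀ => by
    have e := h.2.2 _ (t.comp_sub_left x₀)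
    simp only [t.gradient_comp_sub_left, Pi.zero_apply, smul_zero, integral_zero, neg_zero,
      smul_neg, integral_neg, neg_eq_zero] at e
    have e2 := (InnerProductSpace.toDual ℝ (E n)).toContinuousLinearEquiv.integral_comp_comm
      (μ := volume) (fun z => w z • gradient g (x₀ - z))
    rw [e, map_zero] at e2
    rw [convolution_def, ← e2]
    congr 1
    ext z v
    simp [gradient]
  have d : Differentiable ℝ (convolution w g (ContinuousLinearMap.mul ℝ ℝ) volume) :=
    fun x₀ => (key x₀).differentiableAt
  have c := is_const_of_fderiv_eq_zero d (fun x₀ => by rw [(key x₀).fderiv, zero x₀]) x y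
  simpa [convolution_def] using c

open scoped Pointwise in
-- The pairing with a translated test function does not depend on the translation. Since `p` is
-- finite, `w` is close in `L^p` to a compactly supported `w₁`; translating the test function off
-- the support of `w₁` shows that the constant is arbitrarily small.
theorem IsWeakGrad.ae_eq_zero (hn : n ≠ 0) {p : ENNReal} (hp : 1 ≤ p) (hp' : p ≠ ⊤)
    {w : E n → ℝ} (h : IsWeakGrad w 0) (hw : MemLp w p volume) : w =ᵐ[volume] 0 := by
  refine ae_eq_zero_of_integral_contDiff_smul_eq_zero h.1 fun g₀ hg₀ hc₀ => ?_
  have : NeZero n := ⟨hn⟩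
  have t₀ : IsTestFun univ g₀ := ⟨hg₀, hc₀, subset_univ _⟩
  have t := t₀.comp_sub_left 0
  set g : E n → ℝ := fun y => g₀ (0 - y) with hg
  have e : ∫ x, g₀ x • w x = ∫ z, w z * g (0 - z) := by
    simp [hg, mul_comm]
  rw [e]
  have := ENNReal.HolderConjugate.conjExponent hp
  set q := p.conjExponent
  have bound : ∀ ε : ENNReal, ε ≠ 0 → ‖∫ z, w z * g (0 - z)‖ₑ ≤ ε * eLpNorm g q volume := by
    intro ε hε
    obtain ⟨w₁, hc₁, hle, hcont, hL⟩ := hw.exists_hasCompactSupport_eLpNorm_sub_le hp' hε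
    obtain ⟨x, hx⟩ : ∃ x, x ∉ tsupport w₁ + tsupport g := by
      by_contra! hall
      exact (hc₁.isCompact.add t.2.1.isCompact).ne_univ (eq_univ_of_forall hall)
    have e1 : ∀ z, w₁ z * g (x - z) = 0 := fun z => by
      by_contra hne
      obtain ⟨h1, h2⟩ := mul_ne_zero_iff.1 hne
      exact hx ⟨z, subset_tsupport _ h1, x - z, subset_tsupport _ h2, by simp⟩
    have e2 : ∫ z, w z * g (0 - z) = ∫ z, (w - w₁) z • g (x - z) := by
      rw [h.integral_mul_comp_sub_const t 0 x]
      congr 1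
      ext z
      rw [Pi.sub_apply, smul_eq_mul, sub_mul, e1, sub_zero]
    rw [e2]
    refine (enorm_integral_smul_le (p := p) (q := q) (hw.sub hL).1
      (t.comp_sub_left x).continuous.aestronglyMeasurable).trans ?_
    gcongr
    exact (eLpNorm_comp_measurePreserving t.continuous.aestronglyMeasurable
      (Measure.measurePreserving_sub_left volume x)).le
  have fin : eLpNorm g q volume ≠ ⊤ := (t.memLp q).2.ne
  have lim : Tendsto (fun ε : ENNReal => ε * eLpNorm g q volume) (𝓝[>] 0) (𝓝 0) := by
    have := ENNReal.Tendsto.mul_const (b := eLpNorm g q volume)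
      (tendsto_id.mono_left (nhdsWithin_le_nhds (a := (0 : ENNReal)) (s := Ioi 0))) (Or.inr fin)
    simpa using this
  have := ge_of_tendsto lim (eventually_mem_nhdsWithin.mono fun ε hε => bound ε (ne_of_gt hε))
  simpa using this

/-! ### The Sobolev inequality -/

/-- The critical exponent as an extended nonnegative real. -/
abbrev sobExp (n : ℕ) : ENNReal := ENNReal.ofReal (critExp n)

theorem two_lt_critExp (hn : 3 ≤ n) : 2 < critExp n := by
  have h : (3 : ℝ) ≤ n := by exact_mod_cast hn
  rw [critExp, lt_div_iff₀ (by linarith)]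
  linarith

theorem two_le_sobExp (hn : 3 ≤ n) : 2 ≤ sobExp n := by
  simpa using ENNReal.ofReal_le_ofReal (two_lt_critExp hn).le

theorem one_le_sobExp (hn : 3 ≤ n) : 1 ≤ sobExp n := one_le_two.trans (two_le_sobExp hn)

theorem exists_sobolev_const (hn : 3 ≤ n) : ∃ C : NNReal, ∀ ψ : E n → ℝ, IsTestFun univ ψ →
    eLpNorm ψ (sobExp n) volume ≤ C * eLpNorm (gradient ψ) 2 volume := by
  refine ⟨SNormLESNormFDerivOfEqConst ℝ (volume : Measure (E n)) (2 : NNReal), fun ψ t => ?_⟩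
  have h3 : (3 : ℝ) ≤ n := by exact_mod_cast hn
  have := eLpNorm_le_eLpNorm_fderiv_of_eq (volume : Measure (E n)) t.contDiff_one t.2.1
    (p := 2) (p' := (critExp n).toNNReal) one_le_two (by simp; omega) (by
      rw [Real.coe_toNNReal _ (by linarith [two_lt_critExp hn]), critExp]
      simp only [finrank_euclideanSpace, Fintype.card_fin, NNReal.coe_inv, NNReal.coe_ofNat]
      have : (n : ℝ) - 2 ≠ 0 := by linarith
      have : (n : ℝ) ≠ 0 := by linarith
      field_simp)
  refine this.trans (le_of_eq ?_)
  congr 1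
  exact (eLpNorm_congr_norm_ae (Eventually.of_forall fun x => norm_gradient ψ x)).symm

/-! ### The space of gradients -/

/-- The gradients of the test functions supported in `U`, as elements of `L²`. -/
def testGrad (U : Set (E n)) : Submodule ℝ (Lp (E n) 2 (volume : Measure (E n))) where
  carrier := {g | ∃ ψ : E n → ℝ, IsTestFun U ψ ∧ g =ᵐ[volume] gradient ψ}
  add_mem' := by
    rintro g h ⟨ψ, t, e⟩ ⟨θ, s, f⟩
    refine ⟨ψ + θ, t.add s, ?_⟩
    rw [t.gradient_add s]
    exact (Lp.coeFn_add g h).trans (e.add f)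
  zero_mem' := ⟨0, IsTestFun.zero, by
    have : gradient (0 : E n → ℝ) = 0 := by
      ext1 x
      simp [gradient]
    rw [this]
    exact Lp.coeFn_zero _ _ _⟩
  smul_mem' := by
    rintro c g ⟨ψ, t, e⟩
    refine ⟨c • ψ, t.const_smul c, ?_⟩
    rw [t.gradient_const_smul c]
    exact (Lp.coeFn_smul c g).trans (e.const_smul c)

/-- The closure in `L²` of the gradients of the test functions supported in `U`. -/
def gradSpace (U : Set (E n)) : Submodule ℝ (Lp (E n) 2 (volume : Measure (E n))) :=
  (testGrad U).topologicalClosure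

instance (U : Set (E n)) : CompleteSpace (gradSpace U) :=
  (testGrad U).isClosed_topologicalClosure.completeSpace_coe

theorem IsTestFun.toLp_gradient_mem {U : Set (E n)} {ψ : E n → ℝ} (t : IsTestFun U ψ) :
    (t.memLp_gradient 2).toLp (gradient ψ) ∈ testGrad U :=
  ⟨ψ, t, MemLp.coeFn_toLp _⟩

theorem gradSpace_mono {U W : Set (E n)} (h : U ⊆ W) : gradSpace U ≤ gradSpace W :=
  Submodule.topologicalClosure_mono fun _ ⟨ψ, t, e⟩ => ⟨ψ, t.mono h, e⟩

theorem mem_gradSpace_iff {U : Set (E n)} {g : Lp (E n) 2 (volume : Measure (E n))} :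
    g ∈ gradSpace U ↔ ∀ ε : ENNReal, 0 < ε → ∃ ψ : E n → ℝ, IsTestFun U ψ ∧
      eLpNorm (fun x => g x - gradient ψ x) 2 volume < ε := by
  rw [gradSpace, ← SetLike.mem_coe, Submodule.topologicalClosure_coe, EMetric.mem_closure_iff]
  refine forall₂_congr fun ε _ => ⟨?_, ?_⟩
  · rintro ⟨h, ⟨ψ, t, e⟩, hlt⟩
    refine ⟨ψ, t, ?_⟩
    rw [Lp.edist_def] at hlt
    refine lt_of_eq_of_lt (eLpNorm_congr_ae ?_) hlt
    filter_upwards [e] with x hx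
    simp [hx]
  · rintro ⟨ψ, t, hlt⟩
    refine ⟨_, t.toLp_gradient_mem, ?_⟩
    rw [Lp.edist_def]
    refine lt_of_eq_of_lt (eLpNorm_congr_ae ?_) hlt
    filter_upwards [(t.memLp_gradient 2).coeFn_toLp] with x hx
    simp [hx]

/-- This removes the chosen representative `weakGrad` and moves the question to a closed subspace of
the Hilbert space `L²`. -/
theorem memD0_iff {U : Set (E n)} {u : E n → ℝ} :
    MemD0 U u ↔ MemLp u (sobExp n) volume ∧ ∃ g ∈ gradSpace U, IsWeakGrad u g := by
  constructor
  · rintro ⟨⟨h1, ⟨G, hG⟩, h2⟩, h3⟩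
    refine ⟨h1, h2.toLp _, mem_gradSpace_iff.2 fun ε hε => ?_, ?_⟩
    · obtain ⟨ψ, t, hlt⟩ := h3 ε hε
      refine ⟨ψ, t, lt_of_eq_of_lt (eLpNorm_congr_ae ?_) hlt⟩
      filter_upwards [h2.coeFn_toLp] with x hx
      rw [hx]
    · exact hG.congr (ae_eq_refl u) (hG.weakGrad_ae_eq.symm.trans h2.coeFn_toLp.symm)
  · rintro ⟨h1, g, hg, h2⟩
    refine ⟨⟨h1, ⟨g, h2⟩, (memLp_congr_ae h2.weakGrad_ae_eq).2 (Lp.memLp g)⟩, fun ε hε => ?_⟩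
    obtain ⟨ψ, t, hlt⟩ := mem_gradSpace_iff.1 hg ε hε
    refine ⟨ψ, t, lt_of_eq_of_lt (eLpNorm_congr_ae ?_) hlt⟩
    filter_upwards [h2.weakGrad_ae_eq] with x hx
    rw [hx]

/-- Off `U` the norm of `g` is that of `g - f k`, hence at most the distance from `g` to `f k`. -/
theorem ae_eq_zero_of_tendsto_toLp {F : Type*} [NormedAddCommGroup F] {p : ENNReal}
    [Fact (1 ≤ p)] {U : Set (E n)} (hU : MeasurableSet U)
    {f : ℕ → E n → F} (hf : ∀ k, MemLp (f k) p volume) {g : Lp F p (volume : Measure (E n))}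
    (hz : ∀ k, ∀ x ∉ U, f k x = 0)
    (hl : Tendsto (fun k => (hf k).toLp (f k)) atTop (𝓝 g)) :
    ∀ᵐ x, x ∉ U → g x = 0 := by
  have hp : p ≠ 0 := (zero_lt_one.trans_le Fact.out).ne'
  have hl' : Tendsto (fun k => edist g ((hf k).toLp (f k))) atTop (𝓝 0) := by
    simpa using (tendsto_const_nhds (x := g)).edist hl
  have key : eLpNorm g p (volume.restrict Uᶜ) = 0 := by
    refine le_antisymm (ge_of_tendsto hl' (Eventually.of_forall fun k => ?_)) zero_le
    rw [Lp.edist_def]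
    refine le_trans (le_of_eq (eLpNorm_congr_ae ?_)) (eLpNorm_restrict_le _ _ _ Uᶜ)
    filter_upwards [ae_restrict_mem hU.compl, ae_restrict_of_ae (hf k).coeFn_toLp] with x hx h2
    simp [h2, hz k x hx]
  rw [eLpNorm_eq_zero_iff (Lp.aestronglyMeasurable g).restrict hp] at key
  exact (ae_restrict_iff' hU.compl).1 key

theorem tendsto_eLpNorm_of_tendsto_toLp {F : Type*} [NormedAddCommGroup F] {p : ENNReal}
    [Fact (1 ≤ p)] {f : ℕ → E n → F} (hf : ∀ k, MemLp (f k) p volume)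
    {v : Lp F p (volume : Measure (E n))}
    (hl : Tendsto (fun k => (hf k).toLp (f k)) atTop (𝓝 v)) :
    Tendsto (fun k => eLpNorm (f k - ⇑v) p volume) atTop (𝓝 0) := by
  have h1 : Tendsto (fun k => edist ((hf k).toLp (f k)) v) atTop (𝓝 0) := by
    simpa using hl.edist (tendsto_const_nhds (x := v))
  refine h1.congr fun k => ?_
  rw [Lp.edist_def]
  exact eLpNorm_congr_ae ((hf k).coeFn_toLp.sub (ae_eq_refl _))

theorem tendsto_eLpNorm_toLp {F : Type*} [NormedAddCommGroup F] {p : ENNReal}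
    [Fact (1 ≤ p)] {f : ℕ → E n → F} (hf : ∀ k, MemLp (f k) p volume)
    {v : Lp F p (volume : Measure (E n))}
    (hl : Tendsto (fun k => (hf k).toLp (f k)) atTop (𝓝 v)) :
    Tendsto (fun k => eLpNorm (f k) p volume) atTop (𝓝 (eLpNorm v p volume)) := by
  rw [← Lp.enorm_def]
  refine ((continuous_enorm.tendsto v).comp hl).congr fun k => ?_
  exact Lp.enorm_toLp _

/-- The constant in the Sobolev inequality. -/
def sobConst (hn : 3 ≤ n) : NNReal := (exists_sobolev_const hn).choose

theorem IsTestFun.sobolev (hn : 3 ≤ n) {ψ : E n → ℝ} (t : IsTestFun univ ψ) :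
    eLpNorm ψ (sobExp n) volume ≤ sobConst hn * eLpNorm (gradient ψ) 2 volume :=
  (exists_sobolev_const hn).choose_spec ψ t

/-- The way back from a gradient to a function: by the Sobolev inequality, test functions with
`L²`-Cauchy gradients are Cauchy in `L^{2*}`, and their limit inherits everything that is claimed.
-/
theorem exists_of_mem_gradSpace (hn : 3 ≤ n) {U : Set (E n)} (hU : MeasurableSet U)
    {g : Lp (E n) 2 (volume : Measure (E n))} (hg : g ∈ gradSpace U) :
    ∃ u : E n → ℝ, MemLp u (sobExp n) volume ∧ IsWeakGrad u g ∧
      eLpNorm u (sobExp n) volume ≤ sobConst hn * eLpNorm g 2 volume ∧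
      (∀ᵐ x, x ∉ U → u x = 0) ∧ ∀ᵐ x, x ∉ U → g x = 0 := by
  have : Fact (1 ≤ sobExp n) := ⟨one_le_sobExp hn⟩
  rw [gradSpace, ← SetLike.mem_coe, Submodule.topologicalClosure_coe,
    mem_closure_iff_seq_limit] at hg
  obtain ⟨G, hG, hlim⟩ := hg
  choose ψ t e using hG
  have eG : ∀ k, ((t k).memLp_gradient 2).toLp (gradient (ψ k)) = G k := fun k =>
    Lp.ext ((MemLp.coeFn_toLp _).trans (e k).symm)
  have hlim' : Tendsto (fun k => ((t k).memLp_gradient 2).toLp (gradient (ψ k))) atTop (𝓝 g) := by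
    simpa only [eG] using hlim
  have sob : ∀ j k, edist (((t j).memLp (sobExp n)).toLp (ψ j))
      (((t k).memLp (sobExp n)).toLp (ψ k)) ≤ sobConst hn * edist (G j) (G k) := fun j k => by
    rw [← eG j, ← eG k, Lp.edist_toLp_toLp, Lp.edist_toLp_toLp, ← (t j).gradient_sub (t k)]
    exact ((t j).sub (t k)).to_univ.sobolev hn
  have cau : CauchySeq (fun k => ((t k).memLp (sobExp n)).toLp (ψ k)) := by
    rw [EMetric.cauchySeq_iff]
    intro ε hε
    -- Adding `1` keeps the denominator nonzero.
    obtain ⟨N, hN⟩ := EMetric.cauchySeq_iff.1 hlim.cauchySeq (ε / (sobConst hn + 1))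
      (ENNReal.div_pos hε.ne' (by simp))
    refine ⟨N, fun j hj k hk => ?_⟩
    have h1 := hN j hj k hk
    rw [ENNReal.lt_div_iff_mul_lt (by simp) (by simp)] at h1
    refine lt_of_le_of_lt ((sob j k).trans ?_) h1
    rw [mul_comm]
    gcongr
    exact le_self_add
  obtain ⟨u, hu⟩ := cauchySeq_tendsto_of_complete cau
  refine ⟨u, Lp.memLp u, ?_, ?_,
    ae_eq_zero_of_tendsto_toLp hU _ (fun k x hx => (t k).eq_zero hx) hu,
    ae_eq_zero_of_tendsto_toLp hU _ (fun k x hx => (t k).gradient_eq_zero hx) hlim'⟩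
  · exact IsWeakGrad.of_tendsto (one_le_sobExp hn) one_le_two (fun k => (t k).isWeakGrad)
      (fun k => (t k).memLp _) (fun k => (t k).memLp_gradient _) (Lp.memLp u) (Lp.memLp g)
      (tendsto_eLpNorm_of_tendsto_toLp _ hu) (tendsto_eLpNorm_of_tendsto_toLp _ hlim')
  · exact le_of_tendsto_of_tendsto (tendsto_eLpNorm_toLp _ hu)
      (ENNReal.Tendsto.const_mul (tendsto_eLpNorm_toLp _ hlim') (Or.inr ENNReal.coe_ne_top))
      (Eventually.of_forall fun k => (t k).to_univ.sobolev hn)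

/-- Functions of the critical integrability with the same weak gradient agree. -/
theorem IsWeakGrad.ae_eq_of_memLp (hn : 3 ≤ n) {u v : E n → ℝ} {G : E n → E n}
    (hu : IsWeakGrad u G) (hv : IsWeakGrad v G) (hu' : MemLp u (sobExp n) volume)
    (hv' : MemLp v (sobExp n) volume) : u =ᵐ[volume] v := by
  have h := hu.sub hv
  rw [sub_self] at h
  filter_upwards [h.ae_eq_zero (by omega) (one_le_sobExp hn) ENNReal.ofReal_ne_top (hu'.sub hv')]
    with x hx
  exact sub_eq_zero.1 hx

/-! ### Elements of the space `D_0^{1,2}(U)` -/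

namespace MemD0

variable {U W : Set (E n)} {u v : E n → ℝ}

theorem memLp (h : MemD0 U u) : MemLp u (sobExp n) volume := h.1.1

theorem memLp_weakGrad (h : MemD0 U u) : MemLp (weakGrad u) 2 volume := h.1.2.2

theorem isWeakGrad (h : MemD0 U u) : IsWeakGrad u (weakGrad u) := by
  obtain ⟨G, hG⟩ := h.1.2.1
  exact hG.congr (ae_eq_refl u) hG.weakGrad_ae_eq.symm

theorem toLp_mem (h : MemD0 U u) : h.memLp_weakGrad.toLp (weakGrad u) ∈ gradSpace U := by
  obtain ⟨-, g, hg, hw⟩ := memD0_iff.1 h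
  convert hg using 1
  exact Lp.ext (h.memLp_weakGrad.coeFn_toLp.trans hw.weakGrad_ae_eq)

theorem mono (h : MemD0 U u) (hUW : U ⊆ W) : MemD0 W u := by
  obtain ⟨h1, g, hg, hw⟩ := memD0_iff.1 h
  exact memD0_iff.2 ⟨h1, g, gradSpace_mono hUW hg, hw⟩

theorem sub (h : MemD0 U u) (k : MemD0 U v) : MemD0 U (u - v) := by
  obtain ⟨h1, g, hg, hw⟩ := memD0_iff.1 h
  obtain ⟨k1, f, hf, kw⟩ := memD0_iff.1 k
  exact memD0_iff.2 ⟨h1.sub k1, g - f, sub_mem hg hf,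
    (hw.sub kw).congr (ae_eq_refl _) (Lp.coeFn_sub g f).symm⟩

theorem const_smul (h : MemD0 U u) (c : ℝ) : MemD0 U (c • u) := by
  obtain ⟨h1, g, hg, hw⟩ := memD0_iff.1 h
  exact memD0_iff.2 ⟨h1.const_smul c, c • g, Submodule.smul_mem _ c hg,
    (hw.const_smul c).congr (ae_eq_refl _) (Lp.coeFn_smul c g).symm⟩

theorem weakGrad_sub (h : MemD0 U u) (k : MemD0 U v) :
    weakGrad (u - v) =ᵐ[volume] weakGrad u - weakGrad v :=
  (h.isWeakGrad.sub k.isWeakGrad).weakGrad_ae_eq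

theorem weakGrad_const_smul (h : MemD0 U u) (c : ℝ) :
    weakGrad (c • u) =ᵐ[volume] c • weakGrad u :=
  (h.isWeakGrad.const_smul c).weakGrad_ae_eq

/-- The function rebuilt from the gradient of `u` has these properties, and it is `u` because an
`L^{2*}` function is determined by its weak gradient. -/
theorem properties (hn : 3 ≤ n) (hU : MeasurableSet U) (h : MemD0 U u) :
    eLpNorm u (sobExp n) volume ≤ sobConst hn * eLpNorm (weakGrad u) 2 volume ∧
      (∀ᵐ x, x ∉ U → u x = 0) ∧ ∀ᵐ x, x ∉ U → weakGrad u x = 0 := by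
  obtain ⟨v, hv, hw, hs, z1, z2⟩ := exists_of_mem_gradSpace hn hU h.toLp_mem
  have e := h.memLp_weakGrad.coeFn_toLp
  have huv : u =ᵐ[volume] v :=
    h.isWeakGrad.ae_eq_of_memLp hn (hw.congr (ae_eq_refl v) e) h.memLp hv
  rw [eLpNorm_congr_ae huv, ← eLpNorm_congr_ae e]
  refine ⟨hs, ?_, ?_⟩
  · filter_upwards [huv, z1] with x h1 h2 hx
    rw [h1, h2 hx]
  · filter_upwards [e, z2] with x h1 h2 hx
    rw [← h1, h2 hx]

theorem sobolev (hn : 3 ≤ n) (hU : MeasurableSet U) (h : MemD0 U u) :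
    eLpNorm u (sobExp n) volume ≤ sobConst hn * eLpNorm (weakGrad u) 2 volume :=
  (h.properties hn hU).1

theorem ae_eq_zero (hn : 3 ≤ n) (hU : MeasurableSet U) (h : MemD0 U u) :
    ∀ᵐ x, x ∉ U → u x = 0 :=
  (h.properties hn hU).2.1

theorem weakGrad_ae_eq_zero (hn : 3 ≤ n) (hU : MeasurableSet U) (h : MemD0 U u) :
    ∀ᵐ x, x ∉ U → weakGrad u x = 0 :=
  (h.properties hn hU).2.2

end MemD0

/-! ### The action of the orthogonal group -/

theorem act_one (x : E n) : act 1 x = x := by simp [act]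

theorem act_mul (γ δ : O n) (x : E n) : act (γ * δ) x = act γ (act δ x) := by
  simp [act, Matrix.mulVec_mulVec]

theorem norm_act (γ : O n) (x : E n) : ‖act γ x‖ = ‖x‖ := by
  have h : star (γ : Matrix (Fin n) (Fin n) ℝ) * γ = 1 := Matrix.mem_unitaryGroup_iff'.1 γ.2
  have key : ∀ y : E n, ‖y‖ ^ 2 = WithLp.ofLp y ⬝ᵥ WithLp.ofLp y := fun y => by
    rw [EuclideanSpace.real_norm_sq_eq]
    simp [dotProduct, sq]
  refine (sq_eq_sq₀ (norm_nonneg _) (norm_nonneg _)).1 ?_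
  rw [key, key]
  simp only [act]
  rw [Matrix.dotProduct_mulVec, Matrix.vecMul_mulVec,
    ← Matrix.conjTranspose_eq_transpose_of_trivial,
    ← Matrix.star_eq_conjTranspose, h, Matrix.vecMul_one]

/-- The action of an orthogonal matrix as a linear isometry. -/
def actL (γ : O n) : E n ≃ₗᵢ[ℝ] E n where
  toFun := act γ
  invFun := act γ⁻¹
  map_add' x y := by simp [act, Matrix.mulVec_add]
  map_smul' c x := by simp [act, Matrix.mulVec_smul]
  left_inv x := by rw [← act_mul, inv_mul_cancel, act_one]
  right_inv x := by rw [← act_mul, mul_inv_cancel, act_one]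
  norm_map' x := norm_act γ x

theorem actL_apply (γ : O n) (x : E n) : actL γ x = act γ x := rfl

theorem MemD0.comp_isometry {U : Set (E n)} {u : E n → ℝ} (h : MemD0 U u) (A : E n ≃ₗᵢ[ℝ] E n)
    (hA : A ⁻¹' U ⊆ U) : MemD0 U (u ∘ A) := by
  have hw := h.isWeakGrad.comp_isometry A
  have mp := A.measurePreserving
  have hm : MemLp (fun x => A.symm (weakGrad u (A x))) 2 volume :=
    (A.symm.toContinuousLinearEquiv.toContinuousLinearMap.comp_memLp'
      (h.memLp_weakGrad.comp_measurePreserving mp))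
  refine memD0_iff.2 ⟨h.memLp.comp_measurePreserving mp, hm.toLp _, ?_,
    hw.congr (ae_eq_refl _) hm.coeFn_toLp.symm⟩
  refine mem_gradSpace_iff.2 fun ε hε => ?_
  obtain ⟨ψ, t, hlt⟩ := h.2 ε hε
  refine ⟨ψ ∘ A, (t.comp_isometry A).mono hA, lt_of_eq_of_lt ?_ hlt⟩
  change _ = eLpNorm (weakGrad u - gradient ψ) 2 volume
  rw [← eLpNorm_comp_measurePreserving
    (h.memLp_weakGrad.1.sub t.continuous_gradient.aestronglyMeasurable) mp]
  refine eLpNorm_congr_norm_ae ?_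
  filter_upwards [hm.coeFn_toLp] with x hx
  rw [hx, gradient_comp_isometry t.differentiable, ← map_sub, LinearIsometryEquiv.norm_map]
  rfl

/-! ### Equivariant projections -/

/-- Uniqueness of the nearest point, by Pythagoras. -/
theorem eq_starProjection_of_norm_eq {H : Type*} [NormedAddCommGroup H] [InnerProductSpace ℝ H]
    (K : Submodule ℝ H) [K.HasOrthogonalProjection] {g q : H} (hq : q ∈ K)
    (h : ‖g - q‖ = ‖g - K.starProjection g‖) : q = K.starProjection g := by
  have orth : inner ℝ (g - K.starProjection g) (K.starProjection g - q) = 0 :=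
    K.starProjection_inner_eq_zero g _ (sub_mem (K.starProjection_apply_mem g) hq)
  have e := norm_add_sq_eq_norm_sq_add_norm_sq_of_inner_eq_zero _ _ orth
  rw [sub_add_sub_cancel, h] at e
  have : ‖K.starProjection g - q‖ = 0 := by
    nlinarith [norm_nonneg (K.starProjection g - q)]
  exact (sub_eq_zero.1 (norm_eq_zero.1 this)).symm

/-- Let `v` have as gradient the projection of `∇u` onto `gradSpace U`. The map `w ↦ φ(γ) (w ∘ γ)`
preserves `D_0^{1,2}(U)`, is isometric on gradients and fixes `u`; hence it sends `v` to another
nearest point, which must be `v`. -/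
theorem exists_mem_D0equiv_le (hn : 3 ≤ n) {Γ : Subgroup (O n)} {φ : Γ →* ℤˣ} {U W : Set (E n)}
    (hU : MeasurableSet U) (hinv : IsInvariant Γ U) {u : E n → ℝ} (hu : u ∈ D0equiv Γ φ W) :
    ∃ v ∈ D0equiv Γ φ U, ∀ ψ, IsTestFun U ψ →
      eLpNorm (weakGrad u - weakGrad v) 2 volume ≤
        eLpNorm (weakGrad u - gradient ψ) 2 volume := by
  obtain ⟨hu, hequ⟩ := hu
  set K := gradSpace U
  set g := hu.memLp_weakGrad.toLp (weakGrad u) with hg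
  have eg : g =ᵐ[volume] weakGrad u := hu.memLp_weakGrad.coeFn_toLp
  set p := K.starProjection g with hp
  have pK : p ∈ K := K.starProjection_apply_mem g
  obtain ⟨v, hv, hvw, -⟩ := exists_of_mem_gradSpace hn hU pK
  have hvD : MemD0 U v := memD0_iff.2 ⟨hv, p, pK, hvw⟩
  have ep : weakGrad v =ᵐ[volume] p := hvw.weakGrad_ae_eq
  refine ⟨v, ⟨hvD, fun γ => ?_⟩, fun ψ t => ?_⟩
  · set c : ℝ := (((φ γ : ℤˣ) : ℤ) : ℝ) with hc
    have cc : c * c = 1 := by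
      rw [hc, ← Int.cast_mul, Int.units_coe_mul_self, Int.cast_one]
    have cn : |c| = 1 := by
      have : |c| * |c| = 1 := by rw [← abs_mul, cc, abs_one]
      nlinarith [abs_nonneg c]
    set A := actL (γ : O n) with hA
    have mp := A.measurePreserving
    have hAU : A ⁻¹' U ⊆ U := fun x hx => by
      have := hinv (γ : O n)⁻¹ (Γ.inv_mem γ.2) _ hx
      rwa [hA, actL_apply, ← act_mul, inv_mul_cancel, act_one] at this
    have hv' : MemD0 U (c • (v ∘ A)) := (hvD.comp_isometry A hAU).const_smul c
    have hw' : IsWeakGrad (c • (v ∘ A)) (c • fun x => A.symm (weakGrad v (A x))) :=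
      (hvD.isWeakGrad.comp_isometry A).const_smul c
    have hu' : weakGrad u =ᵐ[volume] c • fun x => A.symm (weakGrad u (A x)) := by
      refine hu.isWeakGrad.ae_eq (((hu.isWeakGrad.comp_isometry A).const_smul c).congr ?_
        (ae_eq_refl _))
      filter_upwards [hequ γ] with x hx
      simp only [Pi.smul_apply, Function.comp_apply, hA, actL_apply, smul_eq_mul, hx]
      rw [← mul_assoc, cc, one_mul]
    have key : hv'.memLp_weakGrad.toLp (weakGrad (c • (v ∘ A))) = p := by
      refine eq_starProjection_of_norm_eq K hv'.toLp_mem ?_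
      rw [Lp.norm_def, Lp.norm_def]
      congr 1
      rw [← eLpNorm_comp_measurePreserving (Lp.aestronglyMeasurable (g - p)) mp]
      refine eLpNorm_congr_norm_ae ?_
      filter_upwards [Lp.coeFn_sub g (hv'.memLp_weakGrad.toLp (weakGrad (c • (v ∘ A)))),
        hv'.memLp_weakGrad.coeFn_toLp, hw'.weakGrad_ae_eq, eg, hu',
        mp.quasiMeasurePreserving.ae_eq_comp (Lp.coeFn_sub g p),
        mp.quasiMeasurePreserving.ae_eq_comp eg,
        mp.quasiMeasurePreserving.ae_eq_comp ep] with x h1 h2 h3 h4 h5 h6 h7 h8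
      simp only [Function.comp_apply] at h6 h7 h8
      rw [h1, Pi.sub_apply, h2, h3, h4, h5, Function.comp_apply, h6, Pi.sub_apply, h7, ← h8,
        Pi.smul_apply, Pi.smul_apply, ← smul_sub, ← map_sub, norm_smul, Real.norm_eq_abs, cn,
        one_mul, LinearIsometryEquiv.norm_map]
    have e1 : weakGrad (c • (v ∘ A)) =ᵐ[volume] p := by
      rw [← key]
      exact hv'.memLp_weakGrad.coeFn_toLp.symm
    -- Equal gradients give equal functions, both being in `L^{2*}`.
    have e2 : c • (v ∘ A) =ᵐ[volume] v :=
      (hv'.isWeakGrad.congr (ae_eq_refl _) e1).ae_eq_of_memLp hn hvw hv'.memLp hv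
    filter_upwards [e2] with x hx
    rw [← hx]
    simp only [Pi.smul_apply, Function.comp_apply, smul_eq_mul]
    rw [← mul_assoc, cc, one_mul, hA, actL_apply]
  · have tK : (t.memLp_gradient 2).toLp (gradient ψ) ∈ K :=
      (testGrad U).le_topologicalClosure t.toLp_gradient_mem
    have hle : ‖g - p‖ₑ ≤ ‖g - (t.memLp_gradient 2).toLp (gradient ψ)‖ₑ := by
      rw [enorm_le_iff_norm_le, hp, K.starProjection_minimal]
      exact ciInf_le ⟨0, by rintro _ ⟨y, rfl⟩; exact norm_nonneg _⟩ (⟨_, tK⟩ : K)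
    rw [Lp.enorm_def, Lp.enorm_def] at hle
    refine (le_of_eq (eLpNorm_congr_ae ?_)).trans (hle.trans (le_of_eq (eLpNorm_congr_ae ?_)))
    · exact (eg.symm.sub ep).trans (Lp.coeFn_sub g p).symm
    · exact (Lp.coeFn_sub _ _).trans (eg.sub (t.memLp_gradient 2).coeFn_toLp)

/-! ### Sets of codimension two have zero capacity -/

theorem integrable_inner_of_memLp_two {α : Type*} [MeasurableSpace α] {μ : Measure α}
    {f g : α → E n} (hf : MemLp f 2 μ) (hg : MemLp g 2 μ) :
    Integrable (fun x => inner ℝ (f x) (g x)) μ := by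
  refine (L2.integrable_inner (𝕜 := ℝ) (hf.toLp f) (hg.toLp g)).congr ?_
  filter_upwards [hf.coeFn_toLp, hg.coeFn_toLp] with x h1 h2
  rw [h1, h2]

/-- A fixed bump on `F` is composed with `ε⁻¹ • L`, so one derivative costs one factor `1 / ε` and
`C` does not depend on `ε`. -/
theorem exists_cutoff {F : Type*} [NormedAddCommGroup F] [NormedSpace ℝ F] [FiniteDimensional ℝ F]
    (L : E n →L[ℝ] F) : ∃ C : ℝ, ∀ ε : ℝ, 0 < ε → ∃ χ : E n → ℝ, ContDiff ℝ ∞ χ ∧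
      (∀ x, |1 - χ x| ≤ 1) ∧ (∀ x, ‖L x‖ < ε → χ x = 1) ∧ (∀ x, 2 * ε ≤ ‖L x‖ → χ x = 0) ∧
      (∀ x, ‖gradient χ x‖ ≤ C / ε) ∧ ∀ x, 2 * ε < ‖L x‖ → gradient χ x = 0 := by
  let f : ContDiffBump (0 : F) := ⟨1, 2, one_pos, one_lt_two⟩
  have fsm : ContDiff ℝ ∞ f := f.contDiff
  obtain ⟨B, hB⟩ := (fsm.continuous_fderiv (by simp)).bounded_above_of_compact_support
    (f.hasCompactSupport.fderiv ℝ)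
  refine ⟨B * ‖L‖, fun ε hε => ?_⟩
  set A : E n →L[ℝ] F := ε⁻¹ • L with hA
  have nA : ∀ x, ‖A x‖ = ‖L x‖ / ε := fun x => by
    simp [hA, norm_smul, abs_of_pos hε, div_eq_inv_mul]
  have hz : ∀ x, 2 * ε ≤ ‖L x‖ → f (A x) = 0 := fun x hx => by
    refine f.zero_of_le_dist ?_
    rw [dist_zero_right, nA, le_div_iff₀ hε]
    exact hx
  refine ⟨fun x => f (A x), fsm.comp A.contDiff, fun x => ?_, fun x hx => ?_, hz, fun x => ?_,
    fun x hx => ?_⟩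
  · rw [abs_le]
    constructor <;> linarith [f.nonneg (x := A x), f.le_one (x := A x)]
  · refine f.one_of_mem_closedBall ?_
    rw [mem_closedBall_zero_iff, nA, div_le_iff₀ hε]
    simpa [f] using hx.le
  · rw [norm_gradient]
    have e : fderiv ℝ (fun x => f (A x)) x = (fderiv ℝ f (A x)).comp A := by
      have := fderiv_comp x (fsm.differentiable (by simp) (A x)) A.differentiableAt
      rwa [A.fderiv] at this
    rw [e]
    refine (ContinuousLinearMap.opNorm_comp_le _ _).trans ?_
    have : ‖A‖ = ‖L‖ / ε := by
      rw [hA, norm_smul, norm_inv, Real.norm_eq_abs, abs_of_pos hε, div_eq_inv_mul]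
    rw [this, mul_div_assoc]
    exact mul_le_mul_of_nonneg_right (hB _) (by positivity)
  · have ev : (fun x => f (A x)) =ᶠ[𝓝 x] fun _ => 0 := by
      have : ∀ᶠ y in 𝓝 x, 2 * ε < ‖L y‖ := (L.continuous.norm.tendsto x).eventually_const_lt hx
      exact this.mono fun y hy => hz y hy.le
    simp [gradient, ev.fderiv_eq]

theorem exists_orthonormalBasis_pair {k : ℕ} {a b : E (k + 2)} (ha : ‖a‖ = 1) (hb : ‖b‖ = 1)
    (hab : inner ℝ a b = 0) : ∃ B : OrthonormalBasis (Fin (k + 2)) ℝ (E (k + 2)),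
      B 0 = a ∧ B 1 = b := by
  let v : Fin (k + 2) → E (k + 2) := fun i => if i = 0 then a else b
  have hv : Orthonormal ℝ (({0, 1} : Set (Fin (k + 2))).domRestrict v) := by
    rw [orthonormal_iff_ite]
    have haa : inner ℝ a a = 1 := by rw [real_inner_self_eq_norm_sq, ha, one_pow]
    have hbb : inner ℝ b b = 1 := by rw [real_inner_self_eq_norm_sq, hb, one_pow]
    have hba : inner ℝ b a = 0 := by rw [real_inner_comm, hab]
    rintro ⟨i, rfl | rfl⟩ ⟨j, rfl | rfl⟩ <;>
      simp [v, Set.domRestrict, hab, haa, hba, hbb, -inner_self_eq_norm_sq_to_K]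
    all_goals exact fun h => absurd (Subtype.mk.inj h) (by simp)
  obtain ⟨B, hB⟩ := hv.exists_orthonormalBasis_extension_of_card_eq (by simp)
  exact ⟨B, by simpa [v] using hB 0 (by simp), by simpa [v] using hB 1 (by simp)⟩

/-- The tube of radius `r` around a subspace of codimension two has volume `O(r²)` in balls. -/
theorem exists_volume_tube_le (hn : 3 ≤ n) {a b : E n} (ha : ‖a‖ = 1) (hb : ‖b‖ = 1)
    (hab : inner ℝ a b = 0) (R : ℝ) : ∃ C : NNReal, ∀ r : ℝ, 0 ≤ r →
      volume {x : E n | (|inner ℝ a x| ≤ r ∧ |inner ℝ b x| ≤ r) ∧ ‖x‖ ≤ R} ≤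
        C * ENNReal.ofReal r ^ 2 := by
  obtain ⟨k, rfl⟩ : ∃ k, n = k + 2 := ⟨n - 2, by omega⟩
  obtain ⟨B, hB0, hB1⟩ := exists_orthonormalBasis_pair ha hb hab
  -- In orthonormal coordinates starting with `a`, `b` the set lies in a box with two sides `2r` and
  -- `k` sides `2R`.
  refine ⟨4 * (2 * R).toNNReal ^ k, fun r hr => ?_⟩
  let s : Fin (k + 2) → ℝ := Fin.cons r (Fin.cons r fun _ => R)
  have sub : {x : E (k + 2) | (|inner ℝ a x| ≤ r ∧ |inner ℝ b x| ≤ r) ∧ ‖x‖ ≤ R} ⊆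
      B.repr ⁻¹' (WithLp.ofLp ⁻¹' Set.pi univ fun i => Icc (-s i) (s i)) := by
    rintro x ⟨⟨h1, h2⟩, h3⟩
    have hi : ∀ i, |inner ℝ (B i) x| ≤ s i := fun i => by
      refine Fin.cases ?_ (fun i => Fin.cases ?_ (fun i => ?_) i) i
      · simpa [s, hB0] using h1
      · simpa [s, hB1] using h2
      · simp only [s, Fin.cons_succ]
        refine (abs_real_inner_le_norm _ _).trans ?_
        rw [B.norm_eq_one, one_mul]
        exact h3
    simp only [mem_preimage, mem_univ_pi, mem_Icc]
    intro i
    have := hi i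
    rw [← B.repr_apply_apply] at this
    exact abs_le.1 this
  refine (measure_mono sub).trans ?_
  have ms : MeasurableSet (Set.pi univ fun i => Icc (-s i) (s i)) :=
    MeasurableSet.univ_pi fun i => measurableSet_Icc
  rw [B.measurePreserving_repr.measure_preimage
      ((PiLp.volume_preserving_ofLp (Fin (k + 2))).measurable ms).nullMeasurableSet,
    (PiLp.volume_preserving_ofLp (Fin (k + 2))).measure_preimage ms.nullMeasurableSet,
    volume_pi_pi]
  simp only [Real.volume_Icc, sub_neg_eq_add, ← two_mul]
  rw [Fin.prod_univ_succ, Fin.prod_univ_succ]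
  simp only [s, Fin.cons_zero, Fin.cons_succ, Finset.prod_const, Finset.card_univ,
    Fintype.card_fin]
  rw [ENNReal.ofReal_mul zero_le_two]
  push_cast
  rw [ENNReal.ofReal_ofNat]
  refine le_of_eq ?_
  rw [show ((2 * R).toNNReal : ENNReal) = ENNReal.ofReal (2 * R) from rfl]
  ring

/-- The product vanishes on an open set around `N`, so even its closed support misses `N`. -/
theorem IsTestFun.one_sub_mul {U N : Set (E n)} {ψ χ : E n → ℝ} (t : IsTestFun U ψ)
    (hχ : ContDiff ℝ ∞ χ) {O : Set (E n)} (hO : IsOpen O) (hN : N ⊆ O) (h1 : ∀ x ∈ O, χ x = 1) :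
    IsTestFun (U \ N) (fun x => (1 - χ x) * ψ x) := by
  refine ⟨(contDiff_const.sub hχ).mul t.1, t.2.1.mul_left, fun x hx => ⟨?_, fun hxN => ?_⟩⟩
  · exact t.2.2 (closure_mono (Function.support_mul_subset_right _ _) hx)
  · have : tsupport (fun x => (1 - χ x) * ψ x) ⊆ Oᶜ := by
      refine closure_minimal (fun y hy hyO => hy ?_) hO.isClosed_compl
      simp [h1 y hyO]
    exact this hx (hN hxN)

/-- Absolute continuity of the integral of `‖Z‖²`. -/
theorem tendsto_eLpNorm_restrict_zero {α F : Type*} [MeasurableSpace α] {μ : Measure α}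
    [NormedAddCommGroup F] {Z : α → F} (hZ : MemLp Z 2 μ) {S : ℕ → Set α}
    (hS : Tendsto (fun k => μ (S k)) atTop (𝓝 0)) :
    Tendsto (fun k => eLpNorm Z 2 (μ.restrict (S k))) atTop (𝓝 0) := by
  have h1 : ∫⁻ x, ‖Z x‖ₑ ^ (2 : ℝ) ∂μ ≠ ⊤ := by
    have := lintegral_rpow_enorm_lt_top_of_eLpNorm_lt_top two_ne_zero ENNReal.ofNat_ne_top hZ.2
    simpa using this.ne
  have h2 := (tendsto_setLIntegral_zero h1 hS).ennrpow_const (1 / 2)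
  rw [ENNReal.zero_rpow_of_pos (by norm_num)] at h2
  refine h2.congr fun k => ?_
  rw [eLpNorm_eq_lintegral_rpow_enorm_toReal two_ne_zero ENNReal.ofNat_ne_top]
  simp

/-- The gradient of a test function is a limit of gradients of test functions that vanish near a
given subspace of codimension at least two. -/
theorem IsTestFun.toLp_gradient_mem_gradSpace_diff (hn : 3 ≤ n) {a b : E n} (ha : ‖a‖ = 1)
    (hb : ‖b‖ = 1) (hab : inner ℝ a b = 0) {U : Set (E n)} {ψ : E n → ℝ} (t : IsTestFun U ψ) :
    (t.memLp_gradient 2).toLp (gradient ψ) ∈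
      gradSpace (U \ {x | inner ℝ a x = 0 ∧ inner ℝ b x = 0}) := by
  set N : Set (E n) := {x | inner ℝ a x = 0 ∧ inner ℝ b x = 0} with hNdef
  -- In codimension two the cutoff terms `ψ ∇χ` are only known to be bounded in `L²`, so the
  -- approximation is weak. This suffices: a closed subspace is its double orthogonal complement,
  -- and it remains to test `∇ψ` against each `z` orthogonal to the subspace.
  rw [← (gradSpace (U \ N)).orthogonal_orthogonal, Submodule.mem_orthogonal']
  intro z hz
  rw [Submodule.mem_orthogonal] at hz
  let L : E n →L[ℝ] ℝ × ℝ := (innerSL ℝ a).prod (innerSL ℝ b)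
  have hL : ∀ x, ∀ r : ℝ, ‖L x‖ ≤ r ↔ |inner ℝ a x| ≤ r ∧ |inner ℝ b x| ≤ r := fun x r => by
    simp [L, Prod.norm_def]
  have hL0 : ∀ x, L x = 0 ↔ x ∈ N := fun x => by simp [L, hNdef]
  obtain ⟨C, hC⟩ := exists_cutoff L
  obtain ⟨R, hR⟩ := t.2.1.isCompact.isBounded.exists_norm_le
  obtain ⟨D, hD⟩ := exists_volume_tube_le hn ha hb hab R
  obtain ⟨M, hM⟩ := t.continuous.bounded_above_of_compact_support t.2.1
  have hM0 : 0 ≤ M := (norm_nonneg _).trans (hM 0)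
  let ε : ℕ → ℝ := fun k => 1 / ((k : ℝ) + 1)
  have ε0 : ∀ k, 0 < ε k := fun k => by positivity
  have εlim : Tendsto ε atTop (𝓝 0) := tendsto_one_div_add_atTop_nhds_zero_nat
  choose χ sm bd one zero grad gz using fun k => hC (ε k) (ε0 k)
  have tk : ∀ k, IsTestFun (U \ N) (fun x => (1 - χ k x) * ψ x) := fun k =>
    t.one_sub_mul (sm k) (O := {x | ‖L x‖ < ε k})
      (isOpen_lt L.continuous.norm continuous_const)
      (fun x hx => by rw [mem_ofPred_eq, (hL0 x).2 hx, norm_zero]; exact ε0 k) (one k)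
  have hgrad : ∀ k x, gradient (fun x => (1 - χ k x) * ψ x) x =
      (1 - χ k x) • gradient ψ x - ψ x • gradient (χ k) x := fun k x => by
    have d : DifferentiableAt ℝ (χ k) x := (sm k).differentiable (by simp) x
    have e : gradient (fun y => 1 - χ k y) x = -gradient (χ k) x := by
      rw [gradient, gradient, fderiv_const_sub, map_neg]
    rw [gradient_mul (d.const_sub 1) (t.differentiable x), e, smul_neg, ← sub_eq_add_neg]
  let S : ℕ → Set (E n) := fun k =>
    {x | (|inner ℝ a x| ≤ 2 * ε k ∧ |inner ℝ b x| ≤ 2 * ε k) ∧ ‖x‖ ≤ R}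
  have Svol : ∀ k, volume (S k) ≤ D * ENNReal.ofReal (2 * ε k) ^ 2 := fun k =>
    hD _ (by linarith [ε0 k])
  have Slim : Tendsto (fun k => volume (S k)) atTop (𝓝 0) := by
    have h1 : Tendsto (fun k => D * ENNReal.ofReal (2 * ε k) ^ 2) atTop (𝓝 0) := by
      have h2 : Tendsto (fun k => ENNReal.ofReal (2 * ε k)) atTop (𝓝 0) := by
        simpa using ENNReal.tendsto_ofReal (εlim.const_mul 2)
      have h3 := ENNReal.Tendsto.const_mul (ENNReal.Tendsto.pow (n := 2) h2)
        (Or.inr (ENNReal.coe_ne_top (r := D)))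
      simpa using h3
    exact tendsto_of_tendsto_of_tendsto_of_le_of_le tendsto_const_nhds h1 (fun _ => zero_le) Svol
  have Soff : ∀ k, ∀ x ∉ S k, ψ x • gradient (χ k) x = 0 := fun k x hx => by
    by_cases hψ : x ∈ tsupport ψ
    · rw [gz k x, smul_zero]
      by_contra hle
      exact hx ⟨(hL x _).1 (not_lt.1 hle), hR x hψ⟩
    · rw [image_eq_zero_of_notMem_tsupport hψ, zero_smul]
  have hZ : MemLp z 2 volume := Lp.memLp z
  have θcont : ∀ k, Continuous fun x => ψ x • gradient (χ k) x := fun k =>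
    t.continuous.smul ((InnerProductSpace.toDual ℝ (E n)).symm.continuous.comp
      ((sm k).continuous_fderiv (by simp)))
  have θmem : ∀ k, MemLp (fun x => ψ x • gradient (χ k) x) 2 volume := fun k =>
    (θcont k).memLp_of_hasCompactSupport t.2.1.smul_right
  have i0 : Integrable fun x => inner ℝ (gradient ψ x) (z x) :=
    integrable_inner_of_memLp_two (t.memLp_gradient 2) hZ
  have i1 : ∀ k, Integrable fun x => inner ℝ ((1 - χ k x) • gradient ψ x) (z x) := fun k => by
    have : MemLp (fun x => (1 - χ k x) • gradient ψ x) 2 volume :=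
      ((continuous_const.sub (sm k).continuous).smul
        t.continuous_gradient).memLp_of_hasCompactSupport t.hasCompactSupport_gradient.smul_left
    exact integrable_inner_of_memLp_two this hZ
  have i2 : ∀ k, Integrable fun x => inner ℝ (ψ x • gradient (χ k) x) (z x) := fun k =>
    integrable_inner_of_memLp_two (θmem k) hZ
  -- This is the orthogonality of `z` to the gradient of `(1 - χ k) ψ`, expanded by the product
  -- rule.
  have eqk : ∀ k, ∫ x, inner ℝ ((1 - χ k x) • gradient ψ x) (z x) =
      ∫ x, inner ℝ (ψ x • gradient (χ k) x) (z x) := fun k => by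
    have h := hz _ ((testGrad _).le_topologicalClosure (tk k).toLp_gradient_mem)
    rw [L2.inner_def] at h
    rw [← sub_eq_zero, ← integral_sub (i1 k) (i2 k), ← h]
    refine integral_congr_ae ?_
    filter_upwards [((tk k).memLp_gradient 2).coeFn_toLp] with x hx
    rw [hx, hgrad, inner_sub_left]
  have lim1 : Tendsto (fun k => ∫ x, inner ℝ ((1 - χ k x) • gradient ψ x) (z x)) atTop
      (𝓝 (∫ x, inner ℝ (gradient ψ x) (z x))) := by
    refine tendsto_integral_of_dominated_convergence (fun x => ‖inner ℝ (gradient ψ x) (z x)‖)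
      (fun k => (i1 k).1) i0.norm (fun k => Eventually.of_forall fun x => ?_) ?_
    · rw [real_inner_smul_left, norm_mul]
      exact mul_le_of_le_one_left (norm_nonneg _) (bd k x)
    -- `N` lies in the hyperplane orthogonal to `a`; off `N` the cutoffs are eventually zero.
    · have null : ∀ᵐ x : E n, x ∉ N := by
        have h0 : volume ((LinearMap.ker (innerSL ℝ a).toLinearMap : Submodule ℝ (E n)) :
            Set (E n)) = 0 := by
          refine Measure.addHaar_submodule _ _ fun htop => ?_
          have : a ∈ LinearMap.ker (innerSL ℝ a).toLinearMap := by rw [htop]; trivial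
          have h1 : inner ℝ a a = (0 : ℝ) := this
          rw [real_inner_self_eq_norm_sq, ha] at h1
          norm_num at h1
        exact measure_mono_null (fun x hx => by simpa using (not_not.1 hx).1) h0
      filter_upwards [null] with x hx
      have hpos : 0 < ‖L x‖ := norm_pos_iff.2 fun h => hx ((hL0 x).1 h)
      have ev : ∀ᶠ k in atTop, 2 * ε k < ‖L x‖ := by
        have := εlim.const_mul 2
        rw [mul_zero] at this
        exact this.eventually_lt_const hpos
      refine tendsto_const_nhds.congr' (ev.mono fun k hk => ?_)
      change _ = inner ℝ ((1 - χ k x) • gradient ψ x) (z x)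
      rw [zero k x hk.le, sub_zero, one_smul]
  have lim2 : Tendsto (fun k => ∫ x, inner ℝ (ψ x • gradient (χ k) x) (z x)) atTop (𝓝 0) := by
    -- The integrand lives on the tube `S k`, where `|ψ ∇χ| ≤ M C / ε` and the volume is `O(ε²)`.
    -- The powers of `ε` cancel, and the decay comes from the norm of `z` on the shrinking tube.
    have bound : ∀ k, ‖∫ x, inner ℝ (ψ x • gradient (χ k) x) (z x)‖ₑ ≤
        ((D : ENNReal) * 4) ^ (2 : ℝ)⁻¹ * ENNReal.ofReal (M * C) *
          eLpNorm z 2 (volume.restrict (S k)) := fun k => by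
      have e : ∫ x, inner ℝ (ψ x • gradient (χ k) x) (z x) =
          ∫ x in S k, inner ℝ (ψ x • gradient (χ k) x) (z x) :=
        (setIntegral_eq_integral_of_forall_compl_eq_zero fun x hx => by
          rw [Soff k x hx, inner_zero_left]).symm
      rw [e]
      refine (enorm_integral_le_lintegral_enorm _).trans ?_
      rw [← eLpNorm_one_eq_lintegral_enorm]
      have hol := eLpNorm_le_eLpNorm_mul_eLpNorm_of_nnnorm (p := 2) (q := 2) (r := 1)
        (μ := volume.restrict (S k)) (θmem k).1.restrict hZ.1.restrict
        (fun x y => inner ℝ x y) 1 (Eventually.of_forall fun x => by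
          rw [one_mul]; exact nnnorm_inner_le_nnnorm _ _)
      refine hol.trans ?_
      rw [ENNReal.coe_one, one_mul]
      gcongr
      have hb := eLpNorm_le_of_ae_bound (p := 2) (μ := volume.restrict (S k))
        (f := fun x => ψ x • gradient (χ k) x) (C := M * (C / ε k))
        (Eventually.of_forall fun x => by
          rw [norm_smul]
          exact mul_le_mul (hM x) (grad k x) (norm_nonneg _) hM0)
      refine hb.trans ?_
      rw [Measure.restrict_apply_univ, ENNReal.toReal_ofNat]
      have h1 : volume (S k) ^ (2 : ℝ)⁻¹ ≤
          ((D : ENNReal) * 4) ^ (2 : ℝ)⁻¹ * ENNReal.ofReal (ε k) := by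
        refine (ENNReal.rpow_le_rpow (Svol k) (by norm_num)).trans (le_of_eq ?_)
        rw [ENNReal.ofReal_mul zero_le_two, mul_pow, ← mul_assoc,
          ENNReal.mul_rpow_of_nonneg _ _ (by norm_num : (0 : ℝ) ≤ 2⁻¹)]
        congr 1
        · norm_num
        · rw [← ENNReal.rpow_natCast, ← ENNReal.rpow_mul]
          norm_num
      refine (mul_le_mul_left h1 _).trans (le_of_eq ?_)
      rw [mul_assoc, ← ENNReal.ofReal_mul (ε0 k).le]
      congr 2
      field_simp [(ε0 k).ne']
    have h0 := ENNReal.Tendsto.const_mul (tendsto_eLpNorm_restrict_zero hZ Slim)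
      (Or.inr (ENNReal.mul_ne_top (ENNReal.rpow_ne_top_of_nonneg (by norm_num : (0 : ℝ) ≤ 2⁻¹)
        (ENNReal.mul_ne_top (ENNReal.coe_ne_top (r := D)) (by norm_num : (4 : ENNReal) ≠ ⊤)))
        (ENNReal.ofReal_ne_top (r := M * C))))
    rw [mul_zero] at h0
    exact tendsto_zero_iff_enorm_tendsto_zero.2
      (tendsto_of_tendsto_of_tendsto_of_le_of_le tendsto_const_nhds h0 (fun _ => zero_le) bound)
  rw [L2.inner_def, ← tendsto_nhds_unique lim1 (lim2.congr fun k => (eqk k).symm)]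
  refine integral_congr_ae ?_
  filter_upwards [(t.memLp_gradient 2).coeFn_toLp] with x hx
  rw [hx]

/-! ### The fixed points form a set of codimension at least two -/

/-- The vectors fixed by all elements of `Γ`. -/
def fixedSpace (Γ : Subgroup (O n)) : Submodule ℝ (E n) where
  carrier := {x | ∀ γ ∈ Γ, act γ x = x}
  add_mem' {x y} hx hy γ hγ := by
    rw [← actL_apply, map_add, actL_apply, actL_apply, hx γ hγ, hy γ hγ]
  zero_mem' γ _ := by rw [← actL_apply, map_zero]
  smul_mem' c x hx γ hγ := by rw [← actL_apply, map_smul, actL_apply, hx γ hγ]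

/-- For `v` fixed, `⟨v, γx⟩ = ⟨γv, γx⟩ = ⟨v, x⟩`. -/
theorem act_sub_mem_orthogonal {Γ : Subgroup (O n)} {γ : O n} (hγ : γ ∈ Γ) (x : E n) :
    act γ x - x ∈ (fixedSpace Γ)ᗮ := by
  rw [Submodule.mem_orthogonal]
  intro v hv
  rw [inner_sub_right, sub_eq_zero]
  nth_rewrite 1 [← hv γ hγ]
  exact (actL γ).inner_map_map v x

/-- Every orbit point is `x + c a` with a fixed vector `a` and has the norm of `x`. This quadratic
equation in `c` leaves only `x` and its reflection in the hyperplane orthogonal to `a`, or `x` alone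
if `a = 0`. -/
theorem finite_orbit {Γ : Subgroup (O n)} (h : Module.finrank ℝ (fixedSpace Γ)ᗮ ≤ 1) (x : E n) :
    (orbit Γ x).Finite := by
  obtain ⟨a, ha⟩ := finrank_le_one_iff.1 h
  refine (Set.toFinite {x, x - (2 * inner ℝ x (a : E n) / ‖(a : E n)‖ ^ 2) • (a : E n)}).subset ?_
  rintro y ⟨γ, hγ, rfl⟩
  obtain ⟨c, hc⟩ := ha ⟨_, act_sub_mem_orthogonal hγ x⟩
  have hc' : c • (a : E n) = act γ x - x := congrArg Subtype.val hc
  have e : act γ x = x + c • (a : E n) := by rw [hc']; abel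
  have hn : ‖x + c • (a : E n)‖ ^ 2 = ‖x‖ ^ 2 := by rw [← e, norm_act]
  rw [norm_add_sq_real, inner_smul_right, norm_smul, mul_pow, Real.norm_eq_abs, sq_abs] at hn
  have hfac : c * (2 * inner ℝ x (a : E n) + c * ‖(a : E n)‖ ^ 2) = 0 := by linarith
  rw [mem_insert_iff, mem_singleton_iff, e]
  rcases mul_eq_zero.1 hfac with h0 | h0
  · left
    rw [h0, zero_smul, add_zero]
  · by_cases ha0 : (a : E n) = 0
    · left
      rw [ha0, smul_zero, add_zero]
    · right
      have : c = -(2 * inner ℝ x (a : E n) / ‖(a : E n)‖ ^ 2) := by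
        have := norm_ne_zero_iff.2 ha0
        field_simp
        linarith
      rw [this, neg_smul, sub_eq_add_neg]

theorem exists_orthonormal_pair_of_dimH_orbit_pos {Γ : Subgroup (O n)} {x : E n}
    (h : 0 < dimH (orbit Γ x)) : ∃ a b : E n, ‖a‖ = 1 ∧ ‖b‖ = 1 ∧ inner ℝ a b = 0 ∧
      ∀ v ∈ fixedSpace Γ, inner ℝ a v = 0 ∧ inner ℝ b v = 0 := by
  have h2 : 1 < Module.finrank ℝ (fixedSpace Γ)ᗮ := by
    by_contra! hle
    exact h.ne' (finite_orbit hle x).dimH_zero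
  let B := stdOrthonormalBasis ℝ (fixedSpace Γ)ᗮ
  let i : Fin (Module.finrank ℝ (fixedSpace Γ)ᗮ) := ⟨0, by omega⟩
  let j : Fin (Module.finrank ℝ (fixedSpace Γ)ᗮ) := ⟨1, h2⟩
  refine ⟨B i, B j, B.norm_eq_one i, B.norm_eq_one j, ?_, fun v hv => ⟨?_, ?_⟩⟩
  · exact B.orthonormal.2 (show i ≠ j by simp [i, j])
  · exact Submodule.inner_left_of_mem_orthogonal hv (B i).2
  · exact Submodule.inner_left_of_mem_orthogonal hv (B j).2

/-! ### Approximation by functions supported away from the fixed points -/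

theorem isOpen_holed {Γ : Subgroup (O n)} {Θ : Set (E n)} (hopen : IsOpen Θ) (δ : ℝ) :
    IsOpen (holed Γ Θ δ) :=
  hopen.inter (isOpen_lt continuous_const (Metric.continuous_infDist_pt _))

theorem holed_subset {Γ : Subgroup (O n)} {Θ : Set (E n)} (δ : ℝ) : holed Γ Θ δ ⊆ Θ :=
  fun _ hx => hx.1

theorem isInvariant_holed {Γ : Subgroup (O n)} {Θ : Set (E n)} (hinv : IsInvariant Γ Θ) (δ : ℝ) :
    IsInvariant Γ (holed Γ Θ δ) := by
  refine fun γ hγ x hx => ⟨hinv γ hγ x hx.1, lt_of_lt_of_eq hx.2 ?_⟩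
  have e : actL γ '' fixedPts Γ Θ = fixedPts Γ Θ := by
    refine (image_congr fun y hy => ?_).trans (image_id _)
    exact hy.2 γ hγ
  nth_rewrite 2 [← e]
  exact (Metric.infDist_image (actL γ).isometry).symm

/-- The closure of the fixed points stays in the closed subspace `fixedSpace Γ`, so the distance to
them has a positive minimum on a nonempty `K`. -/
theorem exists_subset_holed {Γ : Subgroup (O n)} {Θ : Set (E n)} (hfix : (fixedPts Γ Θ).Nonempty)
    {K : Set (E n)} (hK : IsCompact K) (hKΘ : K ⊆ Θ) (hKV : ∀ x ∈ K, x ∉ fixedSpace Γ) :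
    ∃ δ₀ : ℝ, 0 < δ₀ ∧ ∀ δ < δ₀, K ⊆ holed Γ Θ δ := by
  have hpos : ∀ x ∈ K, 0 < Metric.infDist x (fixedPts Γ Θ) := fun x hx => by
    refine (Metric.infDist_pos_iff_notMem_closure hfix).1 fun hcl => hKV x hx ?_
    have : closure (fixedPts Γ Θ) ⊆ fixedSpace Γ :=
      closure_minimal (fun y hy => hy.2) (fixedSpace Γ).closed_of_finiteDimensional
    exact this hcl
  rcases K.eq_empty_or_nonempty with rfl | hne
  · exact ⟨1, one_pos, fun δ _ => empty_subset _⟩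
  · obtain ⟨x, hx, hmin⟩ := hK.exists_isMinOn hne
      (Metric.continuous_infDist_pt (fixedPts Γ Θ)).continuousOn
    exact ⟨_, hpos x hx, fun δ hδ y hy => ⟨hKΘ hy, hδ.trans_le (hmin hy)⟩⟩

/-- An equivariant function on `Θ` is a limit of equivariant functions on the holed domains. -/
theorem exists_tendsto_D0equiv_holed (hn : 3 ≤ n) {Γ : Subgroup (O n)} {φ : Γ →* ℤˣ}
    {Θ : Set (E n)} (hopen : IsOpen Θ) (hinv : IsInvariant Γ Θ) (hfix : (fixedPts Γ Θ).Nonempty)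
    {x : E n} (horbit : 0 < dimH (orbit Γ x)) {u : E n → ℝ} (hu : u ∈ D0equiv Γ φ Θ) :
    ∃ v : ℝ → E n → ℝ, (∀ δ, v δ ∈ D0equiv Γ φ (holed Γ Θ δ)) ∧
      Tendsto (fun δ => eLpNorm (weakGrad (v δ) - weakGrad u) 2 volume) (𝓝[>] 0) (𝓝 0) := by
  choose v hv hmin using fun δ : ℝ =>
    exists_mem_D0equiv_le hn (isOpen_holed hopen δ).measurableSet (isInvariant_holed hinv δ) hu
  refine ⟨v, hv, ?_⟩
  obtain ⟨a, b, ha, hb, hab, hperp⟩ := exists_orthonormal_pair_of_dimH_orbit_pos horbit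
  -- `N` contains the fixed space and has codimension exactly two, whatever the codimension of the
  -- fixed space.
  set N : Set (E n) := {x | inner ℝ a x = 0 ∧ inner ℝ b x = 0}
  have hmem : hu.1.memLp_weakGrad.toLp (weakGrad u) ∈ gradSpace (Θ \ N) := by
    have hle : gradSpace Θ ≤ gradSpace (Θ \ N) := by
      refine Submodule.topologicalClosure_minimal _ ?_
        (testGrad (Θ \ N)).isClosed_topologicalClosure
      rintro g ⟨ψ, t, e⟩
      have : g = (t.memLp_gradient 2).toLp (gradient ψ) :=
        Lp.ext (e.trans (MemLp.coeFn_toLp _).symm)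
      rw [this]
      exact t.toLp_gradient_mem_gradSpace_diff hn ha hb hab
    exact hle hu.1.toLp_mem
  rw [ENNReal.tendsto_nhds_zero]
  intro ε hε
  obtain ⟨ψ, t, hlt⟩ := mem_gradSpace_iff.1 hmem ε hε
  obtain ⟨δ₀, hδ₀, hsub⟩ := exists_subset_holed hfix t.2.1.isCompact
    (fun x hx => (t.2.2 hx).1) (fun x hx hxV => (t.2.2 hx).2 (hperp x hxV))
  filter_upwards [Ioo_mem_nhdsGT hδ₀] with δ hδ
  have t' : IsTestFun (holed Γ Θ δ) ψ := ⟨t.1, t.2.1, hsub δ hδ.2⟩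
  rw [eLpNorm_sub_comm]
  refine (hmin δ ψ t').trans (le_trans (le_of_eq (eLpNorm_congr_ae ?_)) hlt.le)
  filter_upwards [hu.1.memLp_weakGrad.coeFn_toLp] with y hy
  rw [hy, Pi.sub_apply]

/-! ### The energy in terms of a weighted measure -/

/-- The integral is the `p`-th power of the `L^p` norm, which is continuous. -/
theorem tendsto_integral_norm_rpow {α F ι : Type*} [MeasurableSpace α] {μ : Measure α}
    [NormedAddCommGroup F] {p : ℝ} (hp : 1 ≤ p) {q : ENNReal}
    (hq : q = ENNReal.ofReal p) {l : Filter ι} {f : ι → α → F} {g : α → F}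
    (hf : ∀ i, MemLp (f i) q μ) (hg : MemLp g q μ)
    (h : Tendsto (fun i => eLpNorm (f i - g) q μ) l (𝓝 0)) :
    Tendsto (fun i => ∫ x, ‖f i x‖ ^ p ∂μ) l (𝓝 (∫ x, ‖g x‖ ^ p ∂μ)) := by
  subst hq
  have hp0 : 0 < p := by linarith
  have : Fact (1 ≤ ENNReal.ofReal p) := ⟨by simpa using ENNReal.ofReal_le_ofReal hp⟩
  have key : ∀ {k : α → F} (hk : MemLp k (ENNReal.ofReal p) μ),
      ∫ x, ‖k x‖ ^ p ∂μ = ‖hk.toLp k‖ ^ p := fun {k} hk => by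
    have hI : 0 ≤ ∫ x, ‖k x‖ ^ p ∂μ := integral_nonneg fun x => by positivity
    rw [Lp.norm_toLp, hk.eLpNorm_eq_integral_rpow_norm (by simpa using hp0) ENNReal.ofReal_ne_top,
      ENNReal.toReal_ofReal hp0.le, ENNReal.toReal_ofReal (Real.rpow_nonneg hI _),
      ← Real.rpow_mul hI, inv_mul_cancel₀ hp0.ne', Real.rpow_one]
  simp only [key hg, fun i => key (hf i)]
  have hl : Tendsto (fun i => (hf i).toLp (f i)) l (𝓝 (hg.toLp g)) := by
    rw [tendsto_iff_edist_tendsto_0]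
    simpa only [Lp.edist_toLp_toLp] using h
  exact (Real.continuousAt_rpow_const _ _ (Or.inr hp0.le)).tendsto.comp hl.norm

/-- The measure `x_n^m dx` on `Θ`. -/
def weightMeasure (hn : 3 ≤ n) (m : ℕ) (Θ : Set (E n)) : Measure (E n) :=
  (volume.restrict Θ).withDensity fun x => ENNReal.ofReal (lastCoord hn x ^ m)

theorem continuous_lastCoord (hn : 3 ≤ n) : Continuous (lastCoord hn : E n → ℝ) := by
  unfold lastCoord
  fun_prop

theorem measurable_weight (hn : 3 ≤ n) (m : ℕ) :
    Measurable fun x : E n => ENNReal.ofReal (lastCoord hn x ^ m) :=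
  ((continuous_lastCoord hn).pow m).measurable.ennreal_ofReal

/-- Boundedness of `Θ` bounds the weight, so unweighted convergence implies weighted convergence. -/
theorem exists_weightMeasure_le (hn : 3 ≤ n) (m : ℕ) {Θ : Set (E n)} (hΘ : MeasurableSet Θ)
    (hbdd : Bornology.IsBounded Θ) (hpos : ∀ x ∈ Θ, 0 < lastCoord hn x) :
    ∃ c : NNReal, weightMeasure hn m Θ ≤ c • volume.restrict Θ := by
  obtain ⟨R, hR⟩ := hbdd.exists_norm_le
  refine ⟨(R ^ m).toNNReal, ?_⟩
  change _ ≤ ENNReal.ofReal (R ^ m) • volume.restrict Θ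
  rw [weightMeasure, ← withDensity_const]
  refine withDensity_mono ?_
  filter_upwards [ae_restrict_mem hΘ] with x hx
  refine ENNReal.ofReal_le_ofReal (pow_le_pow_left₀ (hpos x hx).le ?_ m)
  exact (le_abs_self _).trans ((PiLp.norm_apply_le x _).trans (hR x hx))

theorem integral_weightMeasure (hn : 3 ≤ n) (m : ℕ) {Θ : Set (E n)} (hΘ : MeasurableSet Θ)
    (hpos : ∀ x ∈ Θ, 0 < lastCoord hn x) (f : E n → ℝ) :
    ∫ x, f x ∂weightMeasure hn m Θ = ∫ x in Θ, lastCoord hn x ^ m * f x := by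
  rw [weightMeasure, integral_withDensity_eq_integral_toReal_smul
    (measurable_weight hn m)
    (Eventually.of_forall fun x => ENNReal.ofReal_lt_top)]
  refine setIntegral_congr_fun hΘ fun x hx => ?_
  simp only [smul_eq_mul]
  rw [ENNReal.toReal_ofReal (pow_nonneg (hpos x hx).le m)]

section

variable (hn : 3 ≤ n) (m : ℕ) {Θ U : Set (E n)} {u v : E n → ℝ}

theorem MemD0.memLp_two (hn : 3 ≤ n) (hbdd : Bornology.IsBounded Θ) (h : MemD0 U u) :
    MemLp u 2 (volume.restrict Θ) := by
  have : IsFiniteMeasure (volume.restrict Θ) := ⟨by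
    rw [Measure.restrict_apply_univ]
    exact hbdd.measure_lt_top⟩
  exact h.memLp.restrict Θ |>.mono_exponent (two_le_sobExp hn)

theorem memLp_weightMeasure (hΘ : MeasurableSet Θ) (hbdd : Bornology.IsBounded Θ)
    (hpos : ∀ x ∈ Θ, 0 < lastCoord hn x)
    {F : Type*} [NormedAddCommGroup F] {p : ENNReal} {f : E n → F}
    (hf : MemLp f p (volume.restrict Θ)) : MemLp f p (weightMeasure hn m Θ) := by
  obtain ⟨c, hc⟩ := exists_weightMeasure_le hn m hΘ hbdd hpos
  exact hf.of_measure_le_smul (c := (c : ENNReal)) ENNReal.coe_ne_top hc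

theorem tendsto_eLpNorm_weightMeasure (hΘ : MeasurableSet Θ) (hbdd : Bornology.IsBounded Θ)
    (hpos : ∀ x ∈ Θ, 0 < lastCoord hn x)
    {F ι : Type*} [NormedAddCommGroup F] {p : ENNReal}
    (hp : p ≠ ⊤) {l : Filter ι} {f : ι → E n → F}
    (hf : Tendsto (fun i => eLpNorm (f i) p (volume.restrict Θ)) l (𝓝 0)) :
    Tendsto (fun i => eLpNorm (f i) p (weightMeasure hn m Θ)) l (𝓝 0) := by
  obtain ⟨c, hc⟩ := exists_weightMeasure_le hn m hΘ hbdd hpos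
  have hl := ENNReal.Tendsto.const_mul (a := (c : ENNReal) ^ (1 / p).toReal) hf
    (Or.inr (ENNReal.rpow_ne_top_of_nonneg (by positivity) ENNReal.coe_ne_top))
  rw [mul_zero] at hl
  refine tendsto_of_tendsto_of_tendsto_of_le_of_le tendsto_const_nhds hl (fun _ => zero_le)
    fun i => ?_
  refine (eLpNorm_mono_measure _ hc).trans (le_of_eq ?_)
  exact eLpNorm_smul_measure_of_ne_top hp _ (c : ENNReal)

/-- Since `u` vanishes off `U`, one measure on `Θ` serves all the holed domains. -/
theorem critTerm_eq (hΘ : MeasurableSet Θ) (hpos : ∀ x ∈ Θ, 0 < lastCoord hn x)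
    (hUΘ : U ⊆ Θ) (hU : MeasurableSet U) (h : MemD0 U u) :
    critTerm hn m U u = ∫ x, ‖u x‖ ^ critExp n ∂weightMeasure hn m Θ := by
  rw [integral_weightMeasure hn m hΘ hpos, critTerm]
  refine (setIntegral_eq_of_subset_of_ae_sdiff_eq_zero hΘ.nullMeasurableSet hUΘ ?_).symm
  filter_upwards [h.ae_eq_zero hn hU] with x hx hxU
  rw [hx hxU.2, abs_zero, Real.zero_rpow (by linarith [two_lt_critExp hn]), mul_zero]

theorem quadForm_eq (hΘ : MeasurableSet Θ) (hbdd : Bornology.IsBounded Θ)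
    (hpos : ∀ x ∈ Θ, 0 < lastCoord hn x)
    (lam : ℝ) (hUΘ : U ⊆ Θ) (hU : MeasurableSet U) (h : MemD0 U u) :
    quadForm hn m lam U u = ∫ x, ‖weakGrad u x‖ ^ (2 : ℝ) ∂weightMeasure hn m Θ +
      lam * ∫ x, ‖u x‖ ^ (2 : ℝ) ∂weightMeasure hn m Θ := by
  have i1 : Integrable (fun x => ‖weakGrad u x‖ ^ (2 : ℝ)) (weightMeasure hn m Θ) := by
    have := memLp_weightMeasure hn m hΘ hbdd hpos (h.memLp_weakGrad.restrict Θ)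
    simpa using this.integrable_norm_rpow two_ne_zero ENNReal.ofNat_ne_top
  have i2 : Integrable (fun x => ‖u x‖ ^ (2 : ℝ)) (weightMeasure hn m Θ) := by
    have := memLp_weightMeasure hn m hΘ hbdd hpos (h.memLp_two hn hbdd)
    simpa using this.integrable_norm_rpow two_ne_zero ENNReal.ofNat_ne_top
  rw [← integral_const_mul, ← integral_add i1 (i2.const_mul lam),
    integral_weightMeasure hn m hΘ hpos, quadForm]
  have e : ∀ x : E n, lastCoord hn x ^ m * ‖weakGrad u x‖ ^ 2 + lam * lastCoord hn x ^ m * u x ^ 2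
      = lastCoord hn x ^ m * (‖weakGrad u x‖ ^ (2 : ℝ) + lam * ‖u x‖ ^ (2 : ℝ)) := fun x => by
    rw [Real.rpow_two, Real.rpow_two, Real.norm_eq_abs, sq_abs]
    ring
  simp only [e]
  refine (setIntegral_eq_of_subset_of_ae_sdiff_eq_zero hΘ.nullMeasurableSet hUΘ ?_).symm
  filter_upwards [h.ae_eq_zero hn hU, h.weakGrad_ae_eq_zero hn hU] with x hx hx' hxU
  simp [hx hxU.2, hx' hxU.2]

/-- The weight is positive on `Θ`, so a zero integral would force `u = 0` there, and `u` vanishes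
elsewhere. -/
theorem critTerm_pos (hΘ : MeasurableSet Θ) (hbdd : Bornology.IsBounded Θ)
    (hpos : ∀ x ∈ Θ, 0 < lastCoord hn x)
    (h : MemD0 Θ u) (hu : ¬ u =ᵐ[volume] 0) : 0 < critTerm hn m Θ u := by
  have hp : 0 < critExp n := by linarith [two_lt_critExp hn]
  have hnn : 0 ≤ᵐ[weightMeasure hn m Θ] fun x => ‖u x‖ ^ critExp n :=
    Eventually.of_forall fun x => by positivity
  have hi : Integrable (fun x => ‖u x‖ ^ critExp n) (weightMeasure hn m Θ) := by
    have := (memLp_weightMeasure hn m hΘ hbdd hpos (h.memLp.restrict Θ)).integrable_norm_rpow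
      (by simpa using hp) ENNReal.ofReal_ne_top
    rwa [ENNReal.toReal_ofReal hp.le] at this
  rw [critTerm_eq hn m hΘ hpos subset_rfl hΘ h]
  refine lt_of_le_of_ne (integral_nonneg_of_ae hnn) fun h0 => hu ?_
  have h1 := (integral_eq_zero_iff_of_nonneg_ae hnn hi).1 h0.symm
  rw [weightMeasure, EventuallyEq, ae_withDensity_iff
    (measurable_weight hn m), ae_restrict_iff' hΘ] at h1
  filter_upwards [h1, h.ae_eq_zero hn hΘ] with x hx hx'
  by_cases hxΘ : x ∈ Θ
  · have := hx hxΘ (by simpa using pow_pos (hpos x hxΘ) m)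
    rw [Pi.zero_apply, Real.rpow_eq_zero (norm_nonneg _) hp.ne'] at this
    simpa using this
  · exact hx' hxΘ

theorem critTerm_const_smul {t : ℝ} (ht : 0 ≤ t) (U : Set (E n)) (u : E n → ℝ) :
    critTerm hn m U (t • u) = t ^ critExp n * critTerm hn m U u := by
  rw [critTerm, critTerm, ← integral_const_mul]
  refine integral_congr_ae (Eventually.of_forall fun x => ?_)
  simp only [Pi.smul_apply, smul_eq_mul]
  rw [abs_mul, abs_of_nonneg ht, Real.mul_rpow ht (abs_nonneg _)]
  ring

theorem quadForm_const_smul (lam t : ℝ) (h : MemD0 U u) :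
    quadForm hn m lam U (t • u) = t ^ 2 * quadForm hn m lam U u := by
  rw [quadForm, quadForm, ← integral_const_mul]
  refine integral_congr_ae (ae_restrict_of_ae ?_)
  filter_upwards [h.weakGrad_const_smul t] with x hx
  rw [hx]
  simp only [Pi.smul_apply, smul_eq_mul, norm_smul, Real.norm_eq_abs, mul_pow, sq_abs]
  ring

/-- Convergence of gradients gives convergence in `L^{2*}` by Sobolev, then in `L²` on the bounded
set `Θ` by Hölder; all three pass to the weighted measure. -/
theorem tendsto_quadForm_critTerm (hΘ : MeasurableSet Θ) (hbdd : Bornology.IsBounded Θ)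
    (hpos : ∀ x ∈ Θ, 0 < lastCoord hn x)
    (lam : ℝ) {V : ℝ → Set (E n)} (hVΘ : ∀ δ, V δ ⊆ Θ)
    (hV : ∀ δ, MeasurableSet (V δ)) {w : ℝ → E n → ℝ} {l : Filter ℝ}
    (hw : ∀ δ, MemD0 (V δ) (w δ)) (hu : MemD0 Θ u)
    (hl : Tendsto (fun δ => eLpNorm (weakGrad (w δ) - weakGrad u) 2 volume) l (𝓝 0)) :
    Tendsto (fun δ => quadForm hn m lam (V δ) (w δ)) l (𝓝 (quadForm hn m lam Θ u)) ∧
      Tendsto (fun δ => critTerm hn m (V δ) (w δ)) l (𝓝 (critTerm hn m Θ u)) := by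
  have hw' : ∀ δ, MemD0 Θ (w δ) := fun δ => (hw δ).mono (hVΘ δ)
  have hle : ∀ {F : Type} [NormedAddCommGroup F] {p : ENNReal} {f : ℝ → E n → F},
      Tendsto (fun δ => eLpNorm (f δ) p volume) l (𝓝 0) →
      Tendsto (fun δ => eLpNorm (f δ) p (volume.restrict Θ)) l (𝓝 0) := fun h =>
    tendsto_of_tendsto_of_tendsto_of_le_of_le tendsto_const_nhds h (fun _ => zero_le)
      fun δ => eLpNorm_restrict_le _ _ _ _
  have lp : Tendsto (fun δ => eLpNorm (w δ - u) (sobExp n) volume) l (𝓝 0) := by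
    have h0 := ENNReal.Tendsto.const_mul hl (Or.inr (ENNReal.coe_ne_top (r := sobConst hn)))
    rw [mul_zero] at h0
    refine tendsto_of_tendsto_of_tendsto_of_le_of_le tendsto_const_nhds h0 (fun _ => zero_le)
      fun δ => ?_
    refine (((hw' δ).sub hu).sobolev hn hΘ).trans (le_of_eq ?_)
    rw [eLpNorm_congr_ae ((hw' δ).weakGrad_sub hu)]
  have l2 : Tendsto (fun δ => eLpNorm (w δ - u) 2 (volume.restrict Θ)) l (𝓝 0) := by
    have h0 := ENNReal.Tendsto.mul_const
      (b := volume Θ ^ (1 / (2 : ENNReal).toReal - 1 / (sobExp n).toReal)) (hle lp)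
      (Or.inr (ENNReal.rpow_ne_top_of_nonneg (by
        have := two_lt_critExp hn
        rw [ENNReal.toReal_ofReal (by linarith), ENNReal.toReal_ofNat, sub_nonneg]
        exact one_div_le_one_div_of_le two_pos this.le) hbdd.measure_lt_top.ne))
    rw [zero_mul] at h0
    refine tendsto_of_tendsto_of_tendsto_of_le_of_le tendsto_const_nhds h0 (fun _ => zero_le)
      fun δ => ?_
    have := eLpNorm_le_eLpNorm_mul_rpow_measure_univ (μ := volume.restrict Θ)
      (two_le_sobExp hn) ((hw' δ).memLp.sub hu.memLp).1.restrict
    rwa [Measure.restrict_apply_univ] at this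
  have two : (2 : ENNReal) = ENNReal.ofReal 2 := (ENNReal.ofReal_ofNat 2).symm
  have m1 := fun {v : E n → ℝ} (h : MemD0 Θ v) =>
    memLp_weightMeasure hn m hΘ hbdd hpos (h.memLp_weakGrad.restrict Θ)
  have m2 := fun {v : E n → ℝ} (h : MemD0 Θ v) =>
    memLp_weightMeasure hn m hΘ hbdd hpos (h.memLp_two hn hbdd)
  have m3 := fun {v : E n → ℝ} (h : MemD0 Θ v) =>
    memLp_weightMeasure hn m hΘ hbdd hpos (h.memLp.restrict Θ)
  have c1 := tendsto_eLpNorm_weightMeasure hn m hΘ hbdd hpos ENNReal.ofNat_ne_top (hle hl)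
  have c2 := tendsto_eLpNorm_weightMeasure hn m hΘ hbdd hpos ENNReal.ofNat_ne_top l2
  have c3 := tendsto_eLpNorm_weightMeasure hn m hΘ hbdd hpos ENNReal.ofReal_ne_top (hle lp)
  rw [quadForm_eq hn m hΘ hbdd hpos lam subset_rfl hΘ hu,
    critTerm_eq hn m hΘ hpos subset_rfl hΘ hu]
  simp only [fun δ => quadForm_eq hn m hΘ hbdd hpos lam (hVΘ δ) (hV δ) (hw δ),
    fun δ => critTerm_eq hn m hΘ hpos (hVΘ δ) (hV δ) (hw δ)]
  have h12 : (1 : ℝ) ≤ 2 := one_le_two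
  exact ⟨(tendsto_integral_norm_rpow h12 two (fun δ => m1 (hw' δ)) (m1 hu) c1).add
    ((tendsto_integral_norm_rpow h12 two (fun δ => m2 (hw' δ)) (m2 hu) c2).const_mul lam),
    tendsto_integral_norm_rpow (by linarith [two_lt_critExp hn]) rfl (fun δ => m3 (hw' δ))
      (m3 hu) c3⟩

end

/-! ### The Nehari manifolds -/

section

variable (hn : 3 ≤ n) (m : ℕ) {Θ U : Set (E n)} {Γ : Subgroup (O n)} {φ : Γ →* ℤˣ}
  {lam : ℝ} {u : E n → ℝ}

theorem nehari_subset (hΘ : MeasurableSet Θ) (hbdd : Bornology.IsBounded Θ)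
    (hpos : ∀ x ∈ Θ, 0 < lastCoord hn x) (hUΘ : U ⊆ Θ) (hU : MeasurableSet U)
    (h : u ∈ nehari hn m lam Γ φ U) :
    u ∈ nehari hn m lam Γ φ Θ ∧ energy hn m lam Θ u = energy hn m lam U u := by
  obtain ⟨⟨hD, heq⟩, hN, h0⟩ := h
  have hD' := hD.mono hUΘ
  have e1 : quadForm hn m lam Θ u = quadForm hn m lam U u := by
    rw [quadForm_eq hn m hΘ hbdd hpos lam subset_rfl hΘ hD',
      quadForm_eq hn m hΘ hbdd hpos lam hUΘ hU hD]
  have e2 : critTerm hn m Θ u = critTerm hn m U u := by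
    rw [critTerm_eq hn m hΘ hpos subset_rfl hΘ hD',
      critTerm_eq hn m hΘ hpos hUΘ hU hD]
  exact ⟨⟨⟨hD', heq⟩, by rw [e1, e2, hN], h0⟩, by rw [energy, energy, e1, e2]⟩

/-- On the Nehari manifold the energy is `(1/2 - 1/2*)` times the critical term. -/
theorem energy_nonneg_of_mem_nehari (hU : MeasurableSet U) (hpos : ∀ x ∈ U, 0 < lastCoord hn x)
    (h : u ∈ nehari hn m lam Γ φ U) : 0 ≤ energy hn m lam U u := by
  have hC : 0 ≤ critTerm hn m U u := setIntegral_nonneg hU fun x hx => by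
    have := hpos x hx
    positivity
  have hp : 1 / critExp n ≤ 1 / 2 := one_div_le_one_div_of_le two_pos (two_lt_critExp hn).le
  rw [energy, h.2.1]
  nlinarith

theorem const_smul_mem_nehari {t : ℝ} (ht : 0 < t) (h : u ∈ D0equiv Γ φ U)
    (h0 : ¬ u =ᵐ[volume] 0)
    (heq : t ^ 2 * quadForm hn m lam U u = t ^ critExp n * critTerm hn m U u) :
    t • u ∈ nehari hn m lam Γ φ U := by
  refine ⟨⟨h.1.const_smul t, fun γ => ?_⟩, ?_, fun hz => h0 ?_⟩
  · filter_upwards [h.2 γ] with x hx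
    simp only [Pi.smul_apply, smul_eq_mul, hx]
    ring
  · rw [quadForm_const_smul hn m lam t h.1, critTerm_const_smul hn m ht.le, heq]
  · filter_upwards [hz] with x hx
    simpa [ht.ne'] using hx

/-- Elements of the Nehari manifold of `Θ` can be approximated in energy by elements of the
Nehari manifolds of the holed domains. -/
theorem eventually_exists_nehari_holed_lt (hopen : IsOpen Θ) (hbdd : Bornology.IsBounded Θ)
    (hpos : ∀ x ∈ Θ, 0 < lastCoord hn x) (hinv : IsInvariant Γ Θ)
    (hfix : (fixedPts Γ Θ).Nonempty) {x : E n} (horbit : 0 < dimH (orbit Γ x))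
    (hu : u ∈ nehari hn m lam Γ φ Θ) {a : ℝ} (ha : energy hn m lam Θ u < a) :
    ∀ᶠ δ in 𝓝[>] (0 : ℝ), ∃ w ∈ nehari hn m lam Γ φ (holed Γ Θ δ),
      energy hn m lam (holed Γ Θ δ) w < a := by
  obtain ⟨huD, huN, hu0⟩ := hu
  have hΘ := hopen.measurableSet
  obtain ⟨v, hv, hlim⟩ := exists_tendsto_D0equiv_holed hn hopen hinv hfix horbit huD
  obtain ⟨limQ, limC⟩ := tendsto_quadForm_critTerm hn m hΘ hbdd hpos lam
    (fun δ => holed_subset (Γ := Γ) (Θ := Θ) δ) (fun δ => (isOpen_holed hopen δ).measurableSet)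
    (fun δ => (hv δ).1) huD.1 hlim
  set Q := fun δ => quadForm hn m lam (holed Γ Θ δ) (v δ)
  set C := fun δ => critTerm hn m (holed Γ Θ δ) (v δ)
  have hC : 0 < critTerm hn m Θ u := critTerm_pos hn m hΘ hbdd hpos huD.1 hu0
  have hp := two_lt_critExp hn
  set p := critExp n
  -- The positive solution of `t² Q = t^p C`, meaningful once `Q` and `C` are positive, which holds
  -- for small `δ`. The limit of `Q / C` is `1` because `u` is on the Nehari manifold.
  set t := fun δ => (Q δ / C δ) ^ (1 / (p - 2))
  have limt : Tendsto t (𝓝[>] 0) (𝓝 1) := by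
    have h1 := limQ.div limC hC.ne'
    rw [huN, div_self hC.ne'] at h1
    have h2 := h1.rpow_const (p := 1 / (p - 2)) (Or.inl one_ne_zero)
    rwa [Real.one_rpow] at h2
  have limE : Tendsto (fun δ => 1 / 2 * (t δ ^ 2 * Q δ) - 1 / p * (t δ ^ p * C δ)) (𝓝[>] 0)
      (𝓝 (energy hn m lam Θ u)) := by
    have h1 := (((limt.pow 2).mul limQ).const_mul (1 / 2)).sub
      (((limt.rpow_const (p := p) (Or.inl one_ne_zero)).mul limC).const_mul (1 / p))
    simpa [energy] using h1
  filter_upwards [limE.eventually_lt_const ha, limQ.eventually_const_lt (huN ▸ hC),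
    limC.eventually_const_lt hC] with δ hE hQ' hC'
  have ht : 0 < t δ := Real.rpow_pos_of_pos (div_pos hQ' hC') _
  have htp : t δ ^ p = t δ ^ 2 * (Q δ / C δ) := by
    have h1 : t δ ^ (p - 2) = Q δ / C δ := by
      rw [← Real.rpow_mul (div_pos hQ' hC').le, one_div_mul_cancel (by linarith), Real.rpow_one]
    rw [← h1, ← Real.rpow_two, ← Real.rpow_add ht, add_sub_cancel]
  refine ⟨t δ • v δ, const_smul_mem_nehari hn m ht (hv δ) (fun h0 => hC'.ne' ?_) ?_, ?_⟩
  · refine (integral_congr_ae (ae_restrict_of_ae ?_)).trans (integral_zero _ _)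
    filter_upwards [h0] with x hx
    rw [hx, Pi.zero_apply, abs_zero, Real.zero_rpow (by linarith), mul_zero]
  · change t δ ^ 2 * Q δ = t δ ^ p * C δ
    rw [htp]
    field_simp
  · rw [energy, quadForm_const_smul hn m lam _ (hv δ).1, critTerm_const_smul hn m ht.le]
    exact hE

end

end HoledDomain

end

/-! ### Convergence of the least energy levels -/

theorem lemma4p2 {n : ℕ} (hn : 3 ≤ n) (m : ℕ) (hm : 1 ≤ m)
    (Γ : Subgroup (HoledDomain.O n)) (hΓ : IsClosed (Γ : Set (HoledDomain.O n)))
    (φ : Γ →* ℤˣ) (hφ : Continuous φ)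
    (Θ : Set (HoledDomain.E n))
    (hopen : IsOpen Θ) (hconn : IsConnected Θ) (hbdd : Bornology.IsBounded Θ)
    (hpos : ∀ x ∈ closure Θ, 0 < HoledDomain.lastCoord hn x)
    (hinv : HoledDomain.IsInvariant Γ Θ)
    (hfix : (HoledDomain.fixedPts Γ Θ).Nonempty)
    (hnonfix : (Θ \ HoledDomain.fixedPts Γ Θ).Nonempty)
    (horbit : ∀ x ∈ Θ \ HoledDomain.fixedPts Γ Θ, 0 < dimH (HoledDomain.orbit Γ x))
    (hA : ∃ x₀ ∈ Θ, ∀ γ : Γ, HoledDomain.act (γ : HoledDomain.O n) x₀ = x₀ → φ γ = 1)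
    (lam : ℝ) (hlam : -HoledDomain.lambda1 hn m Γ φ Θ < lam) :
    Tendsto (fun δ : ℝ => HoledDomain.leastEnergy hn m lam Γ φ (HoledDomain.holed Γ Θ δ))
      (𝓝[>] 0) (𝓝 (HoledDomain.leastEnergy hn m lam Γ φ Θ)) := by
  have hΘ := hopen.measurableSet
  have hpos' : ∀ x ∈ Θ, 0 < HoledDomain.lastCoord hn x := fun x hx => hpos x (subset_closure hx)
  obtain ⟨y, hy⟩ := hnonfix
  have bdd : ∀ U ⊆ Θ, MeasurableSet U → BddBelow
      (HoledDomain.energy hn m lam U '' HoledDomain.nehari hn m lam Γ φ U) := by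
    rintro U hUΘ hU
    refine ⟨0, ?_⟩
    rintro _ ⟨u, hu, rfl⟩
    exact HoledDomain.energy_nonneg_of_mem_nehari hn m hU (fun x hx => hpos' x (hUΘ hx)) hu
  have sub := fun δ : ℝ => HoledDomain.holed_subset (Γ := Γ) (Θ := Θ) δ
  have meas := fun δ : ℝ => (HoledDomain.isOpen_holed (Γ := Γ) hopen δ).measurableSet
  -- If the large manifold is empty, so are the smaller ones, and every level is the default value
  -- `sInf ∅ = 0`.
  rcases (HoledDomain.nehari hn m lam Γ φ Θ).eq_empty_or_nonempty with hE | ⟨u₀, hu₀⟩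
  · have hE' : ∀ δ, HoledDomain.nehari hn m lam Γ φ (HoledDomain.holed Γ Θ δ) = ∅ := fun δ =>
      eq_empty_of_forall_notMem fun u hu => by
        have := (HoledDomain.nehari_subset hn m hΘ hbdd hpos' (sub δ) (meas δ) hu).1
        rwa [hE] at this
    simp only [HoledDomain.leastEnergy, hE, hE', image_empty]
    exact tendsto_const_nhds
  · have approx := fun {u : HoledDomain.E n → ℝ} (hu : u ∈ HoledDomain.nehari hn m lam Γ φ Θ)
        {a : ℝ} (ha : HoledDomain.energy hn m lam Θ u < a) =>
      HoledDomain.eventually_exists_nehari_holed_lt hn m hopen hbdd hpos' hinv hfix (horbit y hy)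
        hu ha
    refine tendsto_order.2 ⟨fun a ha => ?_, fun a ha => ?_⟩
    -- Only the existence of `w` matters here: without it the infimum on the holed domain would be
    -- the default value `0`, possibly below `a`.
    · filter_upwards [approx hu₀ (lt_add_one _)] with δ ⟨w, hw, _⟩
      refine ha.trans_le (le_csInf ⟨_, w, hw, rfl⟩ ?_)
      rintro _ ⟨v, hv, rfl⟩
      obtain ⟨hv', e⟩ := HoledDomain.nehari_subset hn m hΘ hbdd hpos' (sub δ) (meas δ) hv
      rw [← e]
      exact csInf_le (bdd Θ subset_rfl hΘ) ⟨v, hv', rfl⟩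
    · obtain ⟨_, ⟨u, hu, rfl⟩, hlt⟩ := exists_lt_of_csInf_lt (image_nonempty.2 ⟨u₀, hu₀⟩) ha
      filter_upwards [approx hu hlt] with δ ⟨w, hw, hwlt⟩
      exact (csInf_le (bdd _ (sub δ) (meas δ)) ⟨w, hw, rfl⟩).trans_lt hwlt
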